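/- Let $N\ge 0$ and $0\le q\le N$. Let $\Omega\subset\mathbb R^{N+1}$ (coordinates $x_0,\dots,x_N$) be either a smoothly bounded open set, i.e. $\Omega=\{\rho<0\}$ is bounded, with $\rho\in C^\infty(\mathbb R^{N+1})$ and $\nabla\rho\neq 0$ on $b\Omega$, or the half space $\mathbb R^{N+1}_+=\{x_0>0\}$. Let $\bigwedge^{q}(\overline\Omega)$ be the complex-valued $q$-forms $\phi=\sum_I\phi_I\,dx^I$ ($I$ increasing) whose coefficients are smooth on $\overline\Omega$ (restrictions of $C^\infty$ functions on $\mathbb R^{N+1}$), and $\bigwedge^q_0(\overline\Omega)$ those with compact support in $\overline\Omega$. Let $W^1_q(\Omega)$ be the Hilbert space obtained as the closure of $\bigwedge^q_0(\overline\Omega)$ for $$\langle\phi,\psi\rangle_1=\sum_I\sum_{|\alpha|\le 1}\int_\Omega \partial^\alpha\phi_I\,\overline{\partial^\alpha\psi_I}\,dV .$$ Regard the exterior derivative $d$ as a densely defined operator $W^1_q(\Omega)\to W^1_{q+1}(\Omega)$ with domain $\bigwedge^q_0(\overline\Omega)$, and let $d^*:W^1_{q+1}(\Omega)\to W^1_q(\Omega)$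 be its Hilbert space adjoint. Thus $\psi\in W^1_{q+1}(\Omega)$ is in $\mathrm{dom}\,d^*$ if and only if there is $C_\psi$ with $|\langle d\phi,\psi\rangle_1|\le C_\psi\|\phi\|_1$ for all $\phi\in\bigwedge^q_0(\overline\Omega)$. Let $\vec n$ be the outward unit normal on $b\Omega$, $\nabla$ the (flat) covariant derivative, and $\lfloor$ the contraction of a form with a vector in the first slot. Then $$\mathrm{dom}\,d^*\cap\bigwedge\nolimits_0^{q+1}(\overline\Omega)=\Bigl\{\psi\in\bigwedge\nolimits_0^{q+1}(\overline\Omega):\ (\nabla_{\vec n}\psi)\lfloor\vec n\,\bigr|_{b\Omega}=0\Bigr\}$$ (for bounded $\Omega$, $\bigwedge_0^{q+1}(\overline\Omega)=\bigwedge^{q+1}(\overline\Omega)$). On $\Omega=\mathbb R^{N+1}_+$ the condition reads $$\frac{\partial\psi_{0J}}{\partial x_0}\Bigr|_{x_0=0}=0\qquad\text{for all increasing } J,\ |J|=q .\tag{$*$}$$ More precisely, every $\psi\in\bigwedge^{q+1}(\overline{\mathbb R^{N+1}_+})\cap\mathrm{dom}\,d^*$ satisfies $(*)$; conversely, every $\psi\in\bigwedge^{q+1}(\overline{\mathbb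 R^{N+1}_+})$ (in particular every compactly supported one) all of whose derivatives of order at most $2$ are in $L^2(\mathbb R^{N+1}_+)$ and which satisfies $(*)$ is in $\mathrm{dom}\,d^*$. -/

import Mathlib

open MeasureTheory Set Topology
open scoped ContDiff ENNReal LinearPMap

noncomputable section

namespace SobolevHodge

/-- The Euclidean space `ℝ^{N+1}` with coordinates `x₀, …, x_N`. -/
abbrev E (N : ℕ) : Type := EuclideanSpace ℝ (Fin (N + 1))

/-- The coordinate vector field `∂/∂x_j`. -/
def e {N : ℕ} (j : Fin (N + 1)) : E N := EuclideanSpace.single j (1 : ℝ)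

/-- The open half space `{x₀ > 0}`. -/
def halfSpace (N : ℕ) : Set (E N) := {x | 0 < x 0}

/-- `ρ` is a smooth defining function of `Ω`: `Ω = {ρ < 0}` and `∇ρ ≠ 0` on the boundary. -/
structure IsDefiningFunction {N : ℕ} (ρ : E N → ℝ) (Ω : Set (E N)) : Prop where
  contDiff : ContDiff ℝ ∞ ρ
  eq_setOf_neg : Ω = {x | ρ x < 0}
  gradient_ne_zero : ∀ x ∈ frontier Ω, gradient ρ x ≠ 0

/-- The unit outward normal `∇ρ / |∇ρ|`, to be used on the boundary. -/
def unitNormal {N : ℕ} (ρ : E N → ℝ) (x : E N) : E N := ‖gradient ρ x‖⁻¹ • gradient ρ x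

/-! ### The Sobolev space of order one of functions -/

/-- The indices of the partial derivatives of order at most one:
`none` is the function itself and `some j` is `∂/∂x_j`. -/
abbrev Ord1 (N : ℕ) : Type := Option (Fin (N + 1))

/-- The partial derivatives of order at most one of a complex-valued function. -/
def partial1 {N : ℕ} (f : E N → ℂ) : Ord1 N → E N → ℂ
  | none => f
  | some j => fun x => fderiv ℝ f x (e j)

/-- `C_c^∞(ℝ^{N+1})`; the restrictions of these functions to `closure Ω` are the smooth functions
on `closure Ω` with compact support in `closure Ω`. -/
def testFunctions (N : ℕ) : Submodule ℂ (E N → ℂ) where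
  carrier := {f | ContDiff ℝ ∞ f ∧ HasCompactSupport f}
  zero_mem' := ⟨contDiff_const, HasCompactSupport.zero⟩
  add_mem' hf hg := ⟨hf.1.add hg.1, hf.2.add hg.2⟩
  smul_mem' c _ hf := ⟨contDiff_const.smul hf.1, hf.2.smul_left (f := fun _ => c)⟩

theorem memLp_partial1 {N : ℕ} (Ω : Set (E N)) (f : testFunctions N) (a : Ord1 N) :
    MemLp (partial1 (f : E N → ℂ) a) 2 (volume.restrict Ω) := by
  obtain ⟨f, hf, hc⟩ := f
  cases a with
  | none => exact hf.continuous.memLp_of_hasCompactSupport hc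
  | some j =>
    exact ((hf.continuous_fderiv (by simp)).clm_apply
      continuous_const).memLp_of_hasCompactSupport (hc.fderiv_apply ℝ (e j))

theorem partial1_add {N : ℕ} (f g : testFunctions N) (a : Ord1 N) :
    partial1 ((f + g : testFunctions N) : E N → ℂ) a
      = partial1 (f : E N → ℂ) a + partial1 (g : E N → ℂ) a := by
  cases a with
  | none => rfl
  | some j =>
    funext x
    have hf := (f.2.1.differentiable (by simp)) x
    have hg := (g.2.1.differentiable (by simp)) x
    simp only [partial1, Submodule.coe_add, Pi.add_apply]
    rw [fderiv_add hf hg]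
    rfl

theorem partial1_smul {N : ℕ} (c : ℂ) (f : testFunctions N) (a : Ord1 N) :
    partial1 ((c • f : testFunctions N) : E N → ℂ) a = c • partial1 (f : E N → ℂ) a := by
  cases a with
  | none => rfl
  | some j =>
    funext x
    have hf := (f.2.1.differentiable (by simp)) x
    simp only [partial1, Submodule.coe_smul, Pi.smul_apply]
    rw [fderiv_const_smul hf c]
    rfl

/-- Families `(f_α)_{|α| ≤ 1}` in `L²(Ω)`, with the Hilbert sum of the inner products. -/
abbrev L2Jets {N : ℕ} (Ω : Set (E N)) : Type :=
  PiLp 2 (fun _ : Ord1 N => Lp ℂ 2 (volume.restrict Ω))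

/-- The family `(∂^α f)_{|α| ≤ 1}` on `Ω` of a test function `f`; its norm in `L2Jets Ω` is
the Sobolev norm `‖f‖₁`. -/
def jet {N : ℕ} (Ω : Set (E N)) : testFunctions N →ₗ[ℂ] L2Jets Ω where
  toFun f := WithLp.toLp 2 fun a => (memLp_partial1 Ω f a).toLp _
  map_add' f g := by
    ext1 a
    simp only [PiLp.add_apply, ← MemLp.toLp_add, partial1_add]
  map_smul' c f := by
    ext1 a
    simp only [PiLp.smul_apply, RingHom.id_apply, ← MemLp.toLp_const_smul, partial1_smul]

/-- `W¹(Ω)`: the closure of the smooth functions with compact support in `closure Ω`, in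
the norm `‖f‖₁² = ∑_{|α| ≤ 1} ‖∂^α f‖²_{L²(Ω)}`. An element is the family consisting of a function
and of its first derivatives. -/
def W1 {N : ℕ} (Ω : Set (E N)) : Submodule ℂ (L2Jets Ω) :=
  (LinearMap.range (jet Ω)).topologicalClosure

instance {N : ℕ} (Ω : Set (E N)) : CompleteSpace (W1 Ω) :=
  (Submodule.isClosed_topologicalClosure _).completeSpace_coe

/-! ### Differential forms -/

/-- Increasing multi-indices of length `q` in `{0, …, N}`. -/
abbrev MultiIndex (N q : ℕ) : Type := Fin q ↪o Fin (N + 1)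

/-- Complex-valued differential forms of degree `q` on `ℝ^{N+1}`. -/
abbrev Form (N q : ℕ) : Type := E N → E N [⋀^Fin q]→L[ℝ] ℂ

/-- The coefficient `φ_I` in `φ = ∑_I φ_I dx^I`. -/
def coeff {N q : ℕ} (φ : Form N q) (I : MultiIndex N q) : E N → ℂ :=
  fun x => φ x (fun i => e (I i))

/-- `W¹_q(Ω)`: forms of degree `q` with coefficients in `W¹(Ω)`, with the inner product
`⟨φ, ψ⟩₁ = ∑_I ⟨φ_I, ψ_I⟩₁`. -/
def W1Forms {N : ℕ} (Ω : Set (E N)) (q : ℕ) : Type :=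
  PiLp 2 (fun _ : MultiIndex N q => W1 Ω)

instance {N : ℕ} (Ω : Set (E N)) (q : ℕ) : NormedAddCommGroup (W1Forms Ω q) :=
  inferInstanceAs (NormedAddCommGroup (PiLp 2 (fun _ : MultiIndex N q => W1 Ω)))

instance {N : ℕ} (Ω : Set (E N)) (q : ℕ) : InnerProductSpace ℂ (W1Forms Ω q) :=
  inferInstanceAs (InnerProductSpace ℂ (PiLp 2 (fun _ : MultiIndex N q => W1 Ω)))

instance {N : ℕ} (Ω : Set (E N)) (q : ℕ) : CompleteSpace (W1Forms Ω q) :=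
  inferInstanceAs (CompleteSpace (PiLp 2 (fun _ : MultiIndex N q => W1 Ω)))

/-- The coefficient `u_I ∈ W¹(Ω)` of `u ∈ W¹_q(Ω)`. -/
def W1Forms.comp {N q : ℕ} {Ω : Set (E N)} (u : W1Forms Ω q) (I : MultiIndex N q) : W1 Ω :=
  WithLp.ofLp u I

set_option synthInstance.maxHeartbeats 400000 in
set_option maxHeartbeats 1000000 in
/-- The inner product of `W¹_q(Ω)`, written out. -/
theorem W1Forms.inner_eq {N q : ℕ} {Ω : Set (E N)} (u v : W1Forms Ω q) :
    inner ℂ u v = ∑ I : MultiIndex N q, ∑ a : Ord1 N, ∫ x in Ω,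
      inner ℂ (((u.comp I : L2Jets Ω) a : E N → ℂ) x) (((v.comp I : L2Jets Ω) a : E N → ℂ) x) := by
  have h : inner ℂ u v = ∑ I : MultiIndex N q, inner ℂ (u.comp I) (v.comp I) :=
    PiLp.inner_apply (𝕜 := ℂ) (f := fun _ : MultiIndex N q => W1 Ω) u v
  rw [h]
  refine Finset.sum_congr rfl fun I _ => ?_
  rw [Submodule.coe_inner, PiLp.inner_apply]
  exact Finset.sum_congr rfl fun a _ => L2.inner_def _ _

/-- `u ∈ W¹_q(Ω)` is (the class on `Ω` of) the differentiable form `φ`: the coefficients of `u` and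
their first derivatives are those of `φ`, almost everywhere on `Ω`. -/
def Represents {N q : ℕ} {Ω : Set (E N)} (u : W1Forms Ω q) (φ : Form N q) : Prop :=
  ∀ (I : MultiIndex N q) (a : Ord1 N),
    (((u.comp I : L2Jets Ω) a : Lp ℂ 2 (volume.restrict Ω)) : E N → ℂ)
      =ᵐ[volume.restrict Ω] partial1 (coeff φ I) a

/-- Smooth forms with compact support on `ℝ^{N+1}`; their restrictions to `closure Ω` are the
forms that are smooth on `closure Ω` with compact support in `closure Ω`. -/
def testForms (N q : ℕ) : Submodule ℂ (Form N q) where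
  carrier := {φ | ContDiff ℝ ∞ φ ∧ HasCompactSupport φ}
  zero_mem' := ⟨contDiff_const, HasCompactSupport.zero⟩
  add_mem' hf hg := ⟨hf.1.add hg.1, hf.2.add hg.2⟩
  smul_mem' c _ hf := ⟨contDiff_const.smul hf.1, hf.2.smul_left (f := fun _ => c)⟩

/-- Evaluation of alternating forms at a fixed tuple of vectors. -/
def evalAt {N q : ℕ} (v : Fin q → E N) : (E N [⋀^Fin q]→L[ℝ] ℂ) →L[ℝ] ℂ :=
  ContinuousAlternatingMap.apply ℝ (E N) ℂ v

theorem coeff_mem {N q : ℕ} (φ : testForms N q) (I : MultiIndex N q) :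
    coeff (φ : Form N q) I ∈ testFunctions N := by
  refine ⟨?_, ?_⟩
  · exact (evalAt fun i => e (I i)).contDiff.comp φ.2.1
  · exact φ.2.2.comp_left (g := fun η : E N [⋀^Fin q]→L[ℝ] ℂ => η (fun i => e (I i))) rfl

/-- The class in `W¹_q(Ω)` of a test form. -/
def formClass {N : ℕ} (Ω : Set (E N)) (q : ℕ) : testForms N q →ₗ[ℂ] W1Forms Ω q where
  toFun φ := WithLp.toLp 2 fun I =>
    ⟨jet Ω ⟨coeff (φ : Form N q) I, coeff_mem φ I⟩,
      Submodule.le_topologicalClosure _ (LinearMap.mem_range_self _ _)⟩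
  map_add' φ ψ := by
    refine PiLp.ext fun I => ?_
    exact Subtype.ext ((jet Ω).map_add ⟨_, coeff_mem φ I⟩ ⟨_, coeff_mem ψ I⟩)
  map_smul' c φ := by
    refine PiLp.ext fun I => ?_
    exact Subtype.ext ((jet Ω).map_smul c ⟨_, coeff_mem φ I⟩)

theorem represents_formClass {N : ℕ} (Ω : Set (E N)) (q : ℕ) (φ : testForms N q) :
    Represents (formClass Ω q φ) (φ : Form N q) := fun _ a =>
  MemLp.coeFn_toLp (memLp_partial1 Ω _ a)

/-! ### The exterior derivative and its adjoint -/

theorem extDeriv_mem {N q : ℕ} (φ : testForms N q) :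
    extDeriv (φ : Form N q) ∈ testForms N (q + 1) := by
  refine ⟨?_, ?_⟩
  · exact (ContinuousAlternatingMap.alternatizeUncurryFinCLM ℝ (E N) ℂ).contDiff.comp
      (φ.2.1.fderiv_right (m := ∞) (by simp))
  · exact (φ.2.2.fderiv ℝ).comp_left
      (g := fun T => ContinuousAlternatingMap.alternatizeUncurryFin T)
      (ContinuousAlternatingMap.alternatizeUncurryFinCLM ℝ (E N) ℂ).map_zero

/-- The exterior derivative on test forms. -/
def extD (N q : ℕ) : testForms N q →ₗ[ℂ] testForms N (q + 1) where
  toFun φ := ⟨extDeriv (φ : Form N q), extDeriv_mem φ⟩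
  map_add' φ ψ := by
    apply Subtype.ext
    funext x
    exact extDeriv_add (φ.2.1.differentiable (by simp) x) (ψ.2.1.differentiable (by simp) x)
  map_smul' c φ := by
    apply Subtype.ext
    funext x
    have h := φ.2.1.differentiable (by simp) x
    ext v
    simp only [Submodule.coe_smul, RingHom.id_apply, Pi.smul_apply,
      ContinuousAlternatingMap.smul_apply]
    rw [extDeriv_apply (h.const_smul c), extDeriv_apply h, Finset.smul_sum]
    refine Finset.sum_congr rfl fun i _ => ?_
    have hw : DifferentiableAt ℝ (fun y => (φ : Form N q) y (i.removeNth v)) x :=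
      (evalAt (i.removeNth v)).differentiableAt.comp x h
    have hs : fderiv ℝ (fun y => (c • (φ : Form N q)) y (i.removeNth v)) x
        = c • fderiv ℝ (fun y => (φ : Form N q) y (i.removeNth v)) x :=
      fderiv_const_smul hw c
    rw [hs, _root_.smul_apply]
    exact smul_comm ((-1 : ℤ) ^ (i : ℕ)) c _

/-- The graph `{(φ, dφ)}` of the exterior derivative, as a subspace of
`W¹_q(Ω) × W¹_{q+1}(Ω)`. -/
def dGraph {N : ℕ} (Ω : Set (E N)) (q : ℕ) : Submodule ℂ (W1Forms Ω q × W1Forms Ω (q + 1)) :=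
  LinearMap.range ((formClass Ω q).prod (formClass Ω (q + 1) ∘ₗ extD N q))

/-- The unbounded operator `d : W¹_q(Ω) → W¹_{q+1}(Ω)`, defined on the smooth forms with compact
support in `closure Ω`. -/
def dOp {N : ℕ} (Ω : Set (E N)) (q : ℕ) : W1Forms Ω q →ₗ.[ℂ] W1Forms Ω (q + 1) :=
  (dGraph Ω q).toLinearPMap

/-- The Hilbert space adjoint `d^* : W¹_{q+1}(Ω) → W¹_q(Ω)` for the `W¹` inner products. -/
def dStar {N : ℕ} (Ω : Set (E N)) (q : ℕ) : W1Forms Ω (q + 1) →ₗ.[ℂ] W1Forms Ω q :=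
  (dOp Ω q)†

/-- The smooth form `ψ`, restricted to `Ω`, is in the domain of `d^*`. -/
def InDomDStar {N q : ℕ} (Ω : Set (E N)) (ψ : Form N (q + 1)) : Prop :=
  ∃ u ∈ (dStar Ω q).domain, Represents u ψ

/-! ### The boundary condition -/

/-- The contraction `η ⌊ n`, which inserts `n` into the first slot. -/
def contract {N q : ℕ} (η : E N [⋀^Fin (q + 1)]→L[ℝ] ℂ) (n : E N) : E N [⋀^Fin q]→L[ℝ] ℂ :=
  η.curryLeft n

/-- The covariant derivative `∇_n ψ` at `x`, for the flat connection of `ℝ^{N+1}`. -/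
def covDeriv {N q : ℕ} (n : E N) (ψ : Form N q) (x : E N) : E N [⋀^Fin q]→L[ℝ] ℂ :=
  fderiv ℝ ψ x n

/-- The coefficient `ψ_{0J}`. -/
def coeffZero {N q : ℕ} (ψ : Form N (q + 1)) (J : MultiIndex N q) : E N → ℂ :=
  fun x => ψ x (Fin.cons (e 0) fun i => e (J i))

/-- All derivatives of `ψ` of order at most two are in `L²(Ω)`. -/
def IsW2 {N q : ℕ} (Ω : Set (E N)) (ψ : Form N q) : Prop :=
  ∀ k ≤ 2, MemLp (iteratedFDeriv ℝ k ψ) 2 (volume.restrict Ω)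

/-! ### The operator `d` is densely defined and has the expected values -/

theorem coeff_ext {N q : ℕ} {η θ : E N [⋀^Fin q]→L[ℝ] ℂ}
    (h : ∀ I : MultiIndex N q, η (fun i => e (I i)) = θ (fun i => e (I i))) : η = θ := by
  apply ContinuousAlternatingMap.toAlternatingMap_injective
  refine Module.Basis.ext_alternating (EuclideanSpace.basisFun (Fin (N + 1)) ℝ).toBasis ?_
  intro v hv
  have hmono : StrictMono (v ∘ Tuple.sort v) :=
    (Tuple.monotone_sort v).strictMono_of_injective (hv.comp (Tuple.sort v).injective)
  have key := h (OrderEmbedding.ofStrictMono _ hmono)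
  have h1 := (η.toAlternatingMap).map_perm (fun i => e (v i)) (Tuple.sort v)
  have h2 := (θ.toAlternatingMap).map_perm (fun i => e (v i)) (Tuple.sort v)
  have h3 : η.toAlternatingMap ((fun i => e (v i)) ∘ Tuple.sort v)
      = θ.toAlternatingMap ((fun i => e (v i)) ∘ Tuple.sort v) := key
  rw [h1, h2] at h3
  have h4 := (smul_right_injective ℂ (Equiv.Perm.sign (Tuple.sort v)).ne_zero)
  simpa [e] using h3

theorem extDeriv_class_eq_zero {N : ℕ} {Ω : Set (E N)} (hΩ : IsOpen Ω) (q : ℕ)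
    (φ : testForms N q) (h : formClass Ω q φ = 0) :
    formClass Ω (q + 1) (extD N q φ) = 0 := by
  have hφ : ∀ x ∈ Ω, (φ : Form N q) x = 0 := by
    intro x hx
    refine coeff_ext fun I => ?_
    have h0 := represents_formClass Ω q φ I none
    rw [h] at h0
    have h1 : partial1 (coeff (φ : Form N q) I) none =ᵐ[volume.restrict Ω] fun _ => 0 :=
      h0.symm.trans (Lp.coeFn_zero ℂ 2 (volume.restrict Ω))
    have h2 := Measure.eqOn_open_of_ae_eq h1 hΩ
      (coeff_mem φ I).1.continuous.continuousOn continuousOn_const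
    exact h2 hx
  have hd : ∀ x ∈ Ω, extDeriv (φ : Form N q) =ᶠ[𝓝 x] 0 := by
    intro x hx
    filter_upwards [hΩ.mem_nhds hx] with y hy
    have : (φ : Form N q) =ᶠ[𝓝 y] fun _ => 0 := by
      filter_upwards [hΩ.mem_nhds hy] with z hz using hφ z hz
    have h2 := this.fderiv_eq (𝕜 := ℝ)
    rw [fderiv_const_apply] at h2
    simp only [extDeriv, h2]
    exact (ContinuousAlternatingMap.alternatizeUncurryFinCLM ℝ (E N) ℂ).map_zero
  refine PiLp.ext fun I => ?_
  apply Subtype.ext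
  ext1 a
  apply Lp.ext
  refine (represents_formClass Ω (q + 1) (extD N q φ) I a).trans ?_
  refine Filter.EventuallyEq.trans ?_ (Lp.coeFn_zero ℂ 2 (volume.restrict Ω)).symm
  filter_upwards [ae_restrict_mem hΩ.measurableSet] with x hx
  have hc : coeff (extDeriv (φ : Form N q)) I =ᶠ[𝓝 x] fun _ => 0 := by
    filter_upwards [hd x hx] with y hy
    simp [coeff, hy]
  cases a with
  | none => exact hc.self_of_nhds
  | some j =>
    have := hc.fderiv_eq (𝕜 := ℝ)
    rw [fderiv_const_apply] at this
    change fderiv ℝ (coeff (extDeriv (φ : Form N q)) I) x (e j) = 0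
    rw [this]
    rfl

theorem dGraph_graph {N : ℕ} {Ω : Set (E N)} (hΩ : IsOpen Ω) (q : ℕ) :
    (dOp Ω q).graph = dGraph Ω q := by
  refine Submodule.toLinearPMap_graph_eq _ ?_
  rintro _ ⟨φ, rfl⟩ h
  exact extDeriv_class_eq_zero hΩ q φ h

theorem mem_dOp_domain {N : ℕ} (Ω : Set (E N)) (q : ℕ) (u : W1Forms Ω q) :
    u ∈ (dOp Ω q).domain ↔ ∃ φ : testForms N q, formClass Ω q φ = u := by
  simp only [dOp, Submodule.toLinearPMap_domain, dGraph, Submodule.mem_map]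
  constructor
  · rintro ⟨_, ⟨φ, rfl⟩, h⟩
    exact ⟨φ, h⟩
  · rintro ⟨φ, h⟩
    exact ⟨_, ⟨φ, rfl⟩, h⟩

/-- `d` maps the class of `φ` to the class of `dφ`. -/
theorem dOp_formClass {N : ℕ} {Ω : Set (E N)} (hΩ : IsOpen Ω) (q : ℕ) (φ : testForms N q) :
    ∃ h : formClass Ω q φ ∈ (dOp Ω q).domain,
      dOp Ω q ⟨formClass Ω q φ, h⟩ = formClass Ω (q + 1) (extD N q φ) := by
  have h1 : formClass Ω q φ ∈ (dOp Ω q).domain := (mem_dOp_domain Ω q _).2 ⟨φ, rfl⟩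
  refine ⟨h1, Eq.symm ((LinearPMap.image_iff h1).2 ?_)⟩
  rw [dGraph_graph hΩ]
  exact LinearMap.mem_range_self _ φ

/-- The domain of `d^*`: the map `φ ↦ ⟨dφ, u⟩₁` is bounded in the `W¹` norm of `φ`. -/
theorem mem_dStar_domain {N : ℕ} {Ω : Set (E N)} (hΩ : IsOpen Ω) (q : ℕ)
    (u : W1Forms Ω (q + 1)) :
    u ∈ (dStar Ω q).domain ↔ ∃ C : ℝ, ∀ φ : testForms N q,
      ‖inner ℂ u (formClass Ω (q + 1) (extD N q φ))‖ ≤ C * ‖formClass Ω q φ‖ := by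
  rw [dStar, LinearPMap.mem_adjoint_domain_iff]
  constructor
  · intro hc
    refine ⟨‖(⟨_, hc⟩ : (dOp Ω q).domain →L[ℂ] ℂ)‖, fun φ => ?_⟩
    obtain ⟨h, hφ⟩ := dOp_formClass hΩ q φ
    have := (⟨_, hc⟩ : (dOp Ω q).domain →L[ℂ] ℂ).le_opNorm ⟨_, h⟩
    change ‖inner ℂ u (dOp Ω q ⟨_, h⟩)‖ ≤ _ at this
    rwa [hφ] at this
  · rintro ⟨C, hC⟩
    refine AddMonoidHomClass.continuous_of_bound _ C ?_
    rintro ⟨v, hv⟩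
    obtain ⟨φ, rfl⟩ := (mem_dOp_domain Ω q v).1 hv
    obtain ⟨h, hφ⟩ := dOp_formClass hΩ q φ
    change ‖inner ℂ u (dOp Ω q ⟨_, h⟩)‖ ≤ C * ‖formClass Ω q φ‖
    rw [hφ]
    exact hC φ

end SobolevHodge

end

/-!
The domain of the `W¹` adjoint of the exterior derivative is characterised by a boundary condition,
with volume integrals only: neither surface measure nor a trace theorem enters.

Pointwise, `d` is adjoint to contraction (`sum_star_mul_alternatizeUncurryFin`), so that
`inner_formClass_extD` writes `⟨dφ, ψ⟩₁` as a sum over `J` of a first order functional of the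
coefficient `φ_J`, which is bounded in the `W¹` norm as soon as `ψ` is square integrable, and of
`∫_Ω ∑ a_jk ∂_j ∂_k φ_J`, where `a_jk` is the conjugate of `∂_j ψ_{kJ}`. The question is when a second
order functional of functions `f` is bounded by `‖f‖₁`. The answer is: when `∑ ρ_j ρ_k a_jk = 0` on
the boundary, where `ρ` is a defining function and `ρ_j = ∂_j ρ`. This is the condition
`(∇_n ψ) ⌊ n = 0`.

* Sufficiency. Only the symmetric part of `a` matters. Given a vector field `n` with `∑ ρ_j n_j = 1`
  on the boundary, an antisymmetric matrix is added to `a` to obtain `b` with `∑_j ρ_j b_jk = 0` on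
  the boundary (`tangentialPart`). Then the vector field `b ∇f` is tangential, and its divergence
  has integral zero (`integral_divergence_eq_zero`); the second order functional becomes
  `-∫_Ω ∑ (∂_j b_jk) ∂_k f` (`integral_second_order_eq`), which is bounded if the `∂_j b_jk` are square
  integrable.
* Necessity. On the boundary layers `l⁻¹ exp (l ρ) g` the `W¹` norm tends to zero as `l → ∞`, and the
  second order functional is `∫_Ω l exp (l ρ) (∑ ρ_j ρ_k a_jk) g + o(1)`. The measures `l exp (l ρ) dV`
  keep a positive mass near every boundary point (`exists_bump_integral_exp_ge`), so the normal
  component has to vanish (`sum_normal_component_eq_zero`).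

The divergence theorem for tangential fields follows from the one on the whole space with cutoffs in
`ρ`, since a `C¹` function that vanishes on the boundary is `O(ρ)` (`exists_norm_le_mul_abs`).
Everything applies to an arbitrary set with a defining function, in particular to the half space with
`ρ = -x₀`. That a smooth form with square integrable coefficients and first derivatives represents an
element of `W¹` is `exists_represents`.
-/

noncomputable section

namespace SobolevHodge

open Filter

section Analysis

variable {N : ℕ} {V : Type*} [NormedAddCommGroup V] [NormedSpace ℝ V]
  {ρ : E N → ℝ} {Ω : Set (E N)}

/-! ### Defining functions -/

theorem IsDefiningFunction.mem_iff (hρ : IsDefiningFunction ρ Ω) {x : E N} : x ∈ Ω ↔ ρ x < 0 := by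
  rw [hρ.eq_setOf_neg, mem_ofPred_eq]

theorem IsDefiningFunction.isOpen (hρ : IsDefiningFunction ρ Ω) : IsOpen Ω := by
  rw [hρ.eq_setOf_neg]
  exact isOpen_lt hρ.contDiff.continuous continuous_const

theorem IsDefiningFunction.eq_zero (hρ : IsDefiningFunction ρ Ω) {x : E N}
    (hx : x ∈ frontier Ω) : ρ x = 0 := by
  have h1 : x ∉ Ω := by
    have := hx.2
    rwa [hρ.isOpen.interior_eq] at this
  have h2 : x ∈ {y | ρ y ≤ 0} := by
    refine closure_minimal (fun y hy => ?_) (isClosed_le hρ.contDiff.continuous continuous_const)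
      hx.1
    exact (hρ.mem_iff.1 hy).le
  rw [hρ.mem_iff] at h1
  exact le_antisymm h2 (not_lt.1 h1)

theorem fderiv_apply_gradient (hρ : IsDefiningFunction ρ Ω) (x w : E N) :
    fderiv ℝ ρ x w = inner ℝ (gradient ρ x) w := by
  have h := (hρ.contDiff.differentiable (by simp) x).hasGradientAt.hasFDerivAt.fderiv
  rw [h]
  simp

/-- A segment from a point of `s` to a point outside `s` meets the boundary of `s`. -/
theorem exists_mem_segment_frontier {s : Set (E N)} (hs : IsOpen s) {x y : E N}
    (hx : x ∈ s) (hy : y ∉ s) : ∃ z ∈ segment ℝ x y, z ∈ frontier s := by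
  by_contra! hne
  have hpre : IsPreconnected (segment ℝ x y) := (convex_segment x y).isPreconnected
  have hy' : y ∈ (closure s)ᶜ := fun h =>
    hne y (right_mem_segment ℝ x y) ⟨h, by rwa [hs.interior_eq]⟩
  obtain ⟨w, -, hw1, hw2⟩ := hpre s (closure s)ᶜ hs isClosed_closure.isOpen_compl
    (fun z hz => by
      by_cases h : z ∈ s
      · exact Or.inl h
      · exact Or.inr fun h' => hne z hz ⟨h', by rwa [hs.interior_eq]⟩)
    ⟨x, left_mem_segment ℝ x y, hx⟩ ⟨y, right_mem_segment ℝ x y, hy'⟩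
  exact hw2 (subset_closure hw1)

/-- Near a boundary point, a `C¹` function that vanishes on the boundary is `O(ρ)`: moving from `x`
in the direction of the gradient, one leaves `Ω` after a distance comparable to `|ρ x|`. -/
theorem exists_nhds_norm_le_of_mem_frontier (hρ : IsDefiningFunction ρ Ω) {h : E N → V}
    (hh : ContDiff ℝ 1 h) (h0 : ∀ x ∈ frontier Ω, h x = 0) {p : E N} (hp : p ∈ frontier Ω) :
    ∃ C : ℝ, ∃ U ∈ 𝓝 p, ∀ x ∈ U, x ∈ Ω → ‖h x‖ ≤ C * |ρ x| := by
  set v := gradient ρ p with hv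
  have hv0 : 0 < ‖v‖ := norm_pos_iff.2 (hρ.gradient_ne_zero p hp)
  have hvv : fderiv ℝ ρ p v = ‖v‖ ^ 2 := by
    rw [fderiv_apply_gradient hρ, real_inner_self_eq_norm_sq]
  have hs : HasStrictFDerivAt ρ (fderiv ℝ ρ p) p :=
    (hρ.contDiff.contDiffAt).hasStrictFDerivAt (by simp)
  have hd := hs.isLittleO.def (half_pos hv0)
  obtain ⟨δ₁, hδ₁, H₁⟩ := Metric.eventually_nhds_iff.1 hd
  obtain ⟨K, t, ht, hK⟩ := (hh.contDiffAt (x := p)).exists_lipschitzOnWith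
  obtain ⟨δ₂, hδ₂, H₂⟩ := Metric.mem_nhds_iff.1 ht
  set δ := min δ₁ δ₂ with hδ
  have hδ0 : 0 < δ := lt_min hδ₁ hδ₂
  refine ⟨K * (2 / ‖v‖), {x | dist x p + 2 / ‖v‖ * |ρ x| < δ}, ?_, ?_⟩
  · refine IsOpen.mem_nhds (isOpen_lt ?_ continuous_const) ?_
    · exact (continuous_id.dist continuous_const).add
        (continuous_const.mul hρ.contDiff.continuous.abs)
    · simpa [hρ.eq_zero hp] using hδ0
  intro x hx hxΩ
  have hx' : dist x p + 2 / ‖v‖ * |ρ x| < δ := hx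
  have hρx : ρ x < 0 := hρ.mem_iff.1 hxΩ
  set τ := 2 * |ρ x| / ‖v‖ ^ 2 with hτ
  have hτ0 : 0 ≤ τ := by positivity
  -- with this step length the first order estimate gives `ρ y ≥ 0`
  set y := x + τ • v with hy
  have hyx : ‖y - x‖ = 2 / ‖v‖ * |ρ x| := by
    rw [hy, add_sub_cancel_left, norm_smul, Real.norm_of_nonneg hτ0, hτ]
    field_simp
  have hxb : x ∈ Metric.ball p δ := by
    have : 0 ≤ 2 / ‖v‖ * |ρ x| := by positivity
    exact Metric.mem_ball.2 (by linarith)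
  have hyb : y ∈ Metric.ball p δ := by
    have := dist_triangle y x p
    rw [dist_eq_norm y x, hyx] at this
    exact Metric.mem_ball.2 (by linarith)
  have hyΩ : y ∉ Ω := by
    have hyx1 : dist (y, x) (p, p) < δ₁ := by
      rw [Prod.dist_eq]
      exact max_lt (lt_of_lt_of_le hyb (min_le_left _ _)) (lt_of_lt_of_le hxb (min_le_left _ _))
    have h1 := H₁ hyx1
    have h2 : fderiv ℝ ρ p (y - x) = 2 * |ρ x| := by
      rw [hy, add_sub_cancel_left, map_smul, hvv, hτ, smul_eq_mul]
      field_simp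
    rw [h2, hyx, Real.norm_eq_abs] at h1
    have h3 : ‖v‖ / 2 * (2 / ‖v‖ * |ρ x|) = |ρ x| := by field_simp
    rw [h3] at h1
    have h4 := (abs_le.1 h1).1
    rw [abs_of_neg hρx] at h4
    rw [hρ.mem_iff]
    linarith
  obtain ⟨z, hz, hzf⟩ := exists_mem_segment_frontier hρ.isOpen hxΩ hyΩ
  have hzb : z ∈ Metric.ball p δ := (convex_ball p δ).segment_subset hxb hyb hz
  have hzx : dist x z ≤ dist x y := by
    have := (convex_closedBall x (dist x y)).segment_subset
      (Metric.mem_closedBall_self dist_nonneg) (by simp [dist_comm]) hz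
    rwa [Metric.mem_closedBall, dist_comm] at this
  have hL := hK.dist_le_mul x (H₂ (Metric.ball_subset_ball (min_le_right _ _) hxb)) z
    (H₂ (Metric.ball_subset_ball (min_le_right _ _) hzb))
  rw [h0 z hzf, dist_zero_right] at hL
  calc ‖h x‖ ≤ K * dist x z := hL
    _ ≤ K * dist x y := by gcongr
    _ = K * (2 / ‖v‖) * |ρ x| := by rw [dist_comm, dist_eq_norm, hyx]; ring

theorem exists_norm_le_mul_abs (hρ : IsDefiningFunction ρ Ω) {h : E N → V}
    (hh : ContDiff ℝ 1 h) (h0 : ∀ x ∈ frontier Ω, h x = 0) {K : Set (E N)} (hK : IsCompact K) :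
    ∃ C : ℝ, ∀ x ∈ K, x ∈ Ω → ‖h x‖ ≤ C * |ρ x| := by
  refine hK.induction_on (p := fun s => ∃ C : ℝ, ∀ x ∈ s, x ∈ Ω → ‖h x‖ ≤ C * |ρ x|)
    ⟨0, by simp⟩ ?_ ?_ ?_
  · rintro s t hst ⟨C, hC⟩
    exact ⟨C, fun x hx => hC x (hst hx)⟩
  · rintro s t ⟨C, hC⟩ ⟨D, hD⟩
    refine ⟨max C D, fun x hx hxΩ => ?_⟩
    rcases hx with hx | hx
    · exact (hC x hx hxΩ).trans (by gcongr; exact le_max_left _ _)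
    · exact (hD x hx hxΩ).trans (by gcongr; exact le_max_right _ _)
  · intro p _
    by_cases hp : p ∈ Ω
    · have hρp : ρ p ≠ 0 := (hρ.mem_iff.1 hp).ne
      have hc : ContinuousAt (fun x => ‖h x‖ / |ρ x|) p :=
        (hh.continuous.norm.continuousAt).div hρ.contDiff.continuous.abs.continuousAt
          (abs_ne_zero.2 hρp)
      have hev := hc.eventually_lt continuousAt_const (lt_add_one (‖h p‖ / |ρ p|))
      refine ⟨_, mem_nhdsWithin_of_mem_nhds hev, ‖h p‖ / |ρ p| + 1, fun x hx hxΩ => ?_⟩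
      have h1 : 0 < |ρ x| := abs_pos.2 (hρ.mem_iff.1 hxΩ).ne
      exact ((div_lt_iff₀ h1).1 hx).le
    by_cases hp' : p ∈ closure Ω
    · obtain ⟨C, U, hU, H⟩ := exists_nhds_norm_le_of_mem_frontier hρ hh h0
        (p := p) ⟨hp', by rwa [hρ.isOpen.interior_eq]⟩
      exact ⟨U, mem_nhdsWithin_of_mem_nhds hU, C, H⟩
    · exact ⟨(closure Ω)ᶜ, mem_nhdsWithin_of_mem_nhds (isClosed_closure.isOpen_compl.mem_nhds hp'),
        0, fun x hx hxΩ => absurd (subset_closure hxΩ) hx⟩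

/-! ### The divergence theorem for tangential vector fields -/

theorem hasCompactSupport_finsetSum {ι W : Type*} [NormedAddCommGroup W] {s : Finset ι}
    {f : ι → E N → W}
    (hf : ∀ i, HasCompactSupport (f i)) : HasCompactSupport (∑ i ∈ s, f i) :=
  Finset.sum_induction f HasCompactSupport (fun _ _ => HasCompactSupport.add)
    HasCompactSupport.zero fun i _ => hf i

theorem deriv_smoothTransition_eq_zero {t : ℝ} (ht : t ∉ Icc (0 : ℝ) 1) :
    deriv Real.smoothTransition t = 0 := by
  rw [mem_Icc, not_and_or, not_le, not_le] at ht
  rcases ht with ht | ht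
  · have : Real.smoothTransition =ᶠ[𝓝 t] fun _ => 0 := by
      filter_upwards [gt_mem_nhds ht] with s hs using Real.smoothTransition.zero_of_nonpos hs.le
    rw [this.deriv_eq, deriv_const]
  · have : Real.smoothTransition =ᶠ[𝓝 t] fun _ => 1 := by
      filter_upwards [lt_mem_nhds ht] with s hs using Real.smoothTransition.one_of_one_le hs.le
    rw [this.deriv_eq, deriv_const]

theorem exists_abs_deriv_smoothTransition_le :
    ∃ M : ℝ, 0 ≤ M ∧ ∀ t, |deriv Real.smoothTransition t| ≤ M := by
  have hc : Continuous (deriv Real.smoothTransition) :=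
    (Real.smoothTransition.contDiff (n := 1)).continuous_deriv (by simp)
  obtain ⟨M, hM⟩ := (isCompact_Icc (a := (0 : ℝ)) (b := 1)).exists_bound_of_continuousOn
    hc.continuousOn
  refine ⟨max M 0, le_max_right _ _, fun t => ?_⟩
  by_cases ht : t ∈ Icc (0 : ℝ) 1
  · exact (hM t ht).trans (le_max_left _ _)
  · simp [deriv_smoothTransition_eq_zero ht]

/-- The divergence theorem for a vector field with compact support that is tangent to the boundary.
The cutoffs `τ (-1 - n ρ)`, which vanish outside `Ω`, reduce it to the whole space; the terms in
which they are differentiated stay bounded because the normal component is `O(ρ)`. -/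
theorem integral_divergence_eq_zero (hρ : IsDefiningFunction ρ Ω) {F : Fin (N + 1) → E N → V}
    (hF : ∀ j, ContDiff ℝ 1 (F j)) (hc : ∀ j, HasCompactSupport (F j))
    (ht : ∀ x ∈ frontier Ω, ∑ j, fderiv ℝ ρ x (e j) • F j x = 0) :
    ∫ x in Ω, ∑ j, fderiv ℝ (F j) x (e j) = 0 := by
  set τ := Real.smoothTransition
  set χ : ℕ → E N → ℝ := fun n x => τ (-1 - n * ρ x) with hχ
  set h : E N → V := fun x => ∑ j, fderiv ℝ ρ x (e j) • F j x with hh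
  set D : E N → V := fun x => ∑ j, fderiv ℝ (F j) x (e j) with hD
  have hτc : ContDiff ℝ 1 τ := Real.smoothTransition.contDiff (n := 1)
  have hτ0 : ∀ t ≤ 0, τ t = 0 := fun t => Real.smoothTransition.zero_of_nonpos
  have hτ1 : ∀ t, 1 ≤ t → τ t = 1 := fun t => Real.smoothTransition.one_of_one_le
  have hτ' : ∀ t ∉ Icc (0 : ℝ) 1, deriv τ t = 0 := fun t => deriv_smoothTransition_eq_zero
  have hρ1 : ContDiff ℝ 1 ρ := hρ.contDiff.of_le (mod_cast le_top)
  have hχc : ∀ n, ContDiff ℝ 1 (χ n) := fun n =>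
    hτc.comp (contDiff_const.sub (contDiff_const.mul hρ1))
  have hρ' : ∀ j, ContDiff ℝ 1 fun x => fderiv ℝ ρ x (e j) := fun j =>
    ((hρ.contDiff.fderiv_right (m := ∞) (by simp)).clm_apply contDiff_const).of_le
      (mod_cast le_top)
  have hh1 : ContDiff ℝ 1 h := ContDiff.sum fun j _ => (hρ' j).smul (hF j)
  have hF' : ∀ j, Continuous fun x => fderiv ℝ (F j) x (e j) := fun j =>
    ((hF j).continuous_fderiv (by simp)).clm_apply continuous_const
  have hF'c : ∀ j, HasCompactSupport fun x => fderiv ℝ (F j) x (e j) := fun j =>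
    (hc j).fderiv_apply ℝ (e j)
  have hχ' : ∀ n x w, fderiv ℝ (χ n) x w
      = -(n * deriv τ (-1 - n * ρ x)) * fderiv ℝ ρ x w := by
    intro n x w
    have h1 : HasFDerivAt (fun y => -1 - n * ρ y) (-((n : ℝ) • fderiv ℝ ρ x)) x := by
      have := ((hρ1.differentiable (by simp) x).hasFDerivAt.const_mul (n : ℝ)).const_sub (-1)
      exact this
    have h2 := ((hτc.differentiable (by simp) (-1 - n * ρ x)).hasDerivAt).comp_hasFDerivAt x h1
    have h3 : fderiv ℝ (χ n) x = _ := h2.fderiv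
    rw [h3]
    simp
    ring
  -- the integral of the cut off divergence
  have key : ∀ n, ∫ x, χ n x • D x = ∫ x, (n * deriv τ (-1 - n * ρ x)) • h x := by
    intro n
    have i1 : ∀ j, Integrable fun x => fderiv ℝ (χ n) x (e j) • F j x := fun j =>
      (((((hχc n).continuous_fderiv (by simp)).clm_apply continuous_const).smul
        (hF j).continuous)).integrable_of_hasCompactSupport ((hc j).smul_left)
    have i2 : ∀ j, Integrable fun x => χ n x • fderiv ℝ (F j) x (e j) := fun j =>
      ((hχc n).continuous.smul (hF' j)).integrable_of_hasCompactSupport ((hF'c j).smul_left)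
    have i3 : ∀ j, Integrable fun x => χ n x • F j x := fun j =>
      ((hχc n).continuous.smul (hF j).continuous).integrable_of_hasCompactSupport
        ((hc j).smul_left)
    calc ∫ x, χ n x • D x = ∑ j, ∫ x, χ n x • fderiv ℝ (F j) x (e j) := by
          simp only [hD, Finset.smul_sum]
          exact integral_finsetSum _ fun j _ => i2 j
      _ = ∑ j, -∫ x, fderiv ℝ (χ n) x (e j) • F j x := by
          refine Finset.sum_congr rfl fun j _ => ?_
          exact integral_smul_fderiv_eq_neg_fderiv_smul_of_integrable (i1 j) (i2 j) (i3 j)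
            (fun x _ => (hχc n).differentiable (by simp) x)
            (fun x _ => (hF j).differentiable (by simp) x)
      _ = ∫ x, ∑ j, -(fderiv ℝ (χ n) x (e j) • F j x) := by
          rw [integral_finsetSum]
          · simp only [integral_neg]
          · exact fun j _ => (i1 j).neg
      _ = _ := by
          congr 1
          funext x
          simp only [hh, Finset.smul_sum, hχ', smul_smul, neg_mul, neg_smul, neg_neg]
  have hDint : Integrable D := integrable_finsetSum _ fun j _ =>
    (hF' j).integrable_of_hasCompactSupport (hF'c j)
  have outside : ∀ n : ℕ, ∀ x ∉ Ω, -1 - n * ρ x < 0 := by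
    intro n x hx
    rw [hρ.mem_iff, not_lt] at hx
    have : 0 ≤ n * ρ x := by positivity
    linarith
  have inside : ∀ x ∈ Ω, ∀ᶠ n : ℕ in atTop, 1 < -1 - n * ρ x := by
    intro x hx
    rw [hρ.mem_iff] at hx
    have : Tendsto (fun n : ℕ => (n : ℝ) * -ρ x) atTop atTop :=
      tendsto_natCast_atTop_atTop.atTop_mul_const (by linarith)
    filter_upwards [this.eventually_gt_atTop 2] with n hn
    linarith
  have lim1 : Tendsto (fun n => ∫ x, χ n x • D x) atTop (𝓝 (∫ x in Ω, D x)) := by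
    rw [← integral_indicator hρ.isOpen.measurableSet]
    refine tendsto_integral_of_dominated_convergence (fun x => ‖D x‖)
      (fun n => ?_) hDint.norm (fun n => ?_) ?_
    · exact ((hχc n).continuous.aestronglyMeasurable).smul hDint.1
    · refine .of_forall fun x => ?_
      rw [norm_smul, Real.norm_of_nonneg (Real.smoothTransition.nonneg _)]
      exact mul_le_of_le_one_left (norm_nonneg _) (Real.smoothTransition.le_one _)
    · refine .of_forall fun x => ?_
      by_cases hx : x ∈ Ω
      · rw [indicator_of_mem hx]
        refine tendsto_const_nhds.congr' ?_
        filter_upwards [inside x hx] with n hn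
        simp only [hχ]
        rw [hτ1 _ hn.le, one_smul]
      · rw [indicator_of_notMem hx]
        refine tendsto_const_nhds.congr fun n => ?_
        simp only [hχ]
        rw [hτ0 _ (outside n x hx).le, zero_smul]
  obtain ⟨M, hM0, hM⟩ := exists_abs_deriv_smoothTransition_le
  have hhc : HasCompactSupport h := by
    have : h = ∑ j, fun x => fderiv ℝ ρ x (e j) • F j x := by
      funext x
      simp [hh]
    rw [this]
    exact hasCompactSupport_finsetSum fun j => (hc j).smul_left
  obtain ⟨C, hC⟩ := exists_norm_le_mul_abs hρ hh1 ht hhc.isCompact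
  have lim2 : Tendsto (fun n : ℕ => ∫ x, (n * deriv τ (-1 - n * ρ x)) • h x) atTop (𝓝 0) := by
    have h0 : (0 : V) = ∫ _ : E N, (0 : V) := by simp
    rw [h0]
    refine tendsto_integral_of_dominated_convergence
      ((tsupport h).indicator fun _ => 2 * M * |C|) (fun n => ?_) ?_ (fun n => ?_) ?_
    · refine Continuous.aestronglyMeasurable ?_
      exact (continuous_const.mul ((hτc.continuous_deriv (by simp)).comp
        (continuous_const.sub (continuous_const.mul hρ1.continuous)))).smul hh1.continuous
    · exact (integrable_indicator_iff hhc.isCompact.isClosed.measurableSet).2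
        (integrableOn_const hhc.isCompact.measure_lt_top.ne)
    · refine .of_forall fun x => ?_
      by_cases hx : x ∈ tsupport h
      swap
      · simp [image_eq_zero_of_notMem_tsupport hx, indicator_of_notMem hx]
      rw [indicator_of_mem hx]
      by_cases hs : -1 - n * ρ x ∈ Icc (0 : ℝ) 1
      swap
      · rw [hτ' _ hs]
        simp only [mul_zero, zero_smul, norm_zero]
        positivity
      have hxΩ : x ∈ Ω := by
        by_contra hx'
        exact absurd hs.1 (not_le.2 (outside n x hx'))
      have hρx := hρ.mem_iff.1 hxΩ
      have hb := hC x hx hxΩ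
      rw [norm_smul, Real.norm_eq_abs, abs_mul, Nat.abs_cast]
      calc n * |deriv τ (-1 - n * ρ x)| * ‖h x‖ ≤ n * M * (|C| * |ρ x|) := by
            gcongr
            · exact hM _
            · exact hb.trans (by gcongr; exact le_abs_self C)
        _ = (n * |ρ x|) * (M * |C|) := by ring
        _ ≤ 2 * (M * |C|) := by
            gcongr
            rw [abs_of_neg hρx]
            linarith [hs.2]
        _ = 2 * M * |C| := by ring
    · refine .of_forall fun x => ?_
      refine tendsto_const_nhds.congr' ?_
      by_cases hx : x ∈ Ω
      · filter_upwards [inside x hx] with n hn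
        rw [hτ' _ fun h => absurd h.2 (not_le.2 hn)]
        simp
      · refine .of_forall fun n => ?_
        beta_reduce
        rw [hτ' _ fun h => absurd h.1 (not_le.2 (outside n x hx))]
        simp
  have := tendsto_nhds_unique lim1 (by simpa only [key] using lim2)
  exact this

/-! ### Second order functionals with vanishing normal component -/

theorem sum_coord_smul_e (v : E N) : ∑ j, v j • e j = v := by
  ext i
  simp [e, Pi.single_apply]

theorem map_eq_sum_coord {W : Type*} [AddCommMonoid W] [Module ℝ W] (L : E N →ₗ[ℝ] W) (v : E N) :
    L v = ∑ j, v j • L (e j) := by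
  conv_lhs => rw [← sum_coord_smul_e v]
  simp [map_sum]

theorem contDiff_fderiv_apply {f : E N → V} (hf : ContDiff ℝ ∞ f) (w : E N) :
    ContDiff ℝ ∞ fun x => fderiv ℝ f x w :=
  (hf.fderiv_right (m := ∞) (by simp)).clm_apply contDiff_const

theorem fderiv_fderiv_apply {f : E N → V} (hf : ContDiff ℝ ∞ f) (x w z : E N) :
    fderiv ℝ (fun y => fderiv ℝ f y w) x z = fderiv ℝ (fderiv ℝ f) x z w := by
  have h : DifferentiableAt ℝ (fderiv ℝ f) x :=
    (hf.fderiv_right (m := ∞) (by simp)).differentiable (by simp) x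
  rw [fderiv_clm_apply h (differentiableAt_const w)]
  simp

theorem fderiv_fderiv_comm {f : E N → V} (hf : ContDiff ℝ ∞ f) (x w z : E N) :
    fderiv ℝ (fderiv ℝ f) x z w = fderiv ℝ (fderiv ℝ f) x w z :=
  (hf.contDiffAt.isSymmSndFDerivAt
    (by rw [minSmoothness_of_isRCLikeNormedField]; exact WithTop.coe_le_coe.2 (le_top (a := (2 : ℕ∞))))) z w

/-- Matrices with the same symmetric part have the same sum against a symmetric matrix. -/
theorem sum_mul_eq_of_symm {ι : Type*} [Fintype ι] {a b H : ι → ι → ℂ}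
    (hab : ∀ j k, b j k + b k j = a j k + a k j) (hH : ∀ j k, H j k = H k j) :
    ∑ j, ∑ k, a j k * H j k = ∑ j, ∑ k, b j k * H j k := by
  have key : ∀ c : ι → ι → ℂ,
      2 * ∑ j, ∑ k, c j k * H j k = ∑ j, ∑ k, (c j k + c k j) * H j k := by
    intro c
    have h1 : ∑ j, ∑ k, c k j * H j k = ∑ j, ∑ k, c j k * H j k := by
      rw [Finset.sum_comm]
      simp only [hH]
    simp only [add_mul, Finset.sum_add_distrib, h1]
    ring
  have h2 : 2 * ∑ j, ∑ k, a j k * H j k = 2 * ∑ j, ∑ k, b j k * H j k := by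
    simp only [key, hab]
  exact mul_left_cancel₀ two_ne_zero h2

/-- A second order functional is of first order if its coefficient matrix has the same symmetric
part as a matrix `b` whose rows contract to zero with the normal: then `b ∇f` is tangential. -/
theorem integral_second_order_eq (hρ : IsDefiningFunction ρ Ω)
    {a b : Fin (N + 1) → Fin (N + 1) → E N → ℂ} (hb : ∀ j k, ContDiff ℝ ∞ (b j k))
    (hab : ∀ j k x, b j k x + b k j x = a j k x + a k j x)
    (ht : ∀ x ∈ frontier Ω, ∀ k, ∑ j, fderiv ℝ ρ x (e j) • b j k x = 0)
    {f : E N → ℂ} (hf : f ∈ testFunctions N) :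
    ∫ x in Ω, ∑ j, ∑ k, a j k x * fderiv ℝ (fderiv ℝ f) x (e j) (e k)
      = -∫ x in Ω, ∑ j, ∑ k, fderiv ℝ (b j k) x (e j) * fderiv ℝ f x (e k) := by
  obtain ⟨hf, hc⟩ := hf
  have hfk : ∀ k, ContDiff ℝ ∞ fun x => fderiv ℝ f x (e k) := fun k =>
    contDiff_fderiv_apply hf (e k)
  have hfc : ∀ k, HasCompactSupport fun x => fderiv ℝ f x (e k) := fun k =>
    hc.fderiv_apply ℝ (e k)
  have hF : ∀ j, ContDiff ℝ ∞ fun x => ∑ k, b j k x * fderiv ℝ f x (e k) := fun j =>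
    ContDiff.sum fun k _ => (hb j k).mul (hfk k)
  have hFc : ∀ j, HasCompactSupport fun x => ∑ k, b j k x * fderiv ℝ f x (e k) := by
    intro j
    have : (fun x => ∑ k, b j k x * fderiv ℝ f x (e k))
        = ∑ k, fun x => b j k x * fderiv ℝ f x (e k) := by
      funext x
      simp
    rw [this]
    exact hasCompactSupport_finsetSum fun k => (hfc k).mul_left
  have hdiv := integral_divergence_eq_zero hρ (F := fun j x => ∑ k, b j k x * fderiv ℝ f x (e k))
    (fun j => (hF j).of_le (mod_cast le_top)) hFc (by
      intro x hx
      simp only [Finset.smul_sum]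
      rw [Finset.sum_comm]
      refine Finset.sum_eq_zero fun k _ => ?_
      simp only [← smul_mul_assoc, ← Finset.sum_mul, ht x hx k, zero_mul])
  have hterm : ∀ x, ∑ j, fderiv ℝ (fun y => ∑ k, b j k y * fderiv ℝ f y (e k)) x (e j)
      = ∑ j, ∑ k, a j k x * fderiv ℝ (fderiv ℝ f) x (e j) (e k)
        + ∑ j, ∑ k, fderiv ℝ (b j k) x (e j) * fderiv ℝ f x (e k) := by
    intro x
    rw [sum_mul_eq_of_symm (a := fun j k => a j k x) (b := fun j k => b j k x)
      (fun j k => hab j k x) fun j k => fderiv_fderiv_comm hf x (e k) (e j),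
      ← Finset.sum_add_distrib]
    refine Finset.sum_congr rfl fun j _ => ?_
    rw [← Finset.sum_add_distrib, fderiv_fun_sum fun k _ =>
      (((hb j k).mul (hfk k)).differentiable (by simp) x)]
    rw [_root_.sum_apply]
    refine Finset.sum_congr rfl fun k _ => ?_
    rw [fderiv_fun_mul ((hb j k).differentiable (by simp) x)
      ((hfk k).differentiable (by simp) x)]
    simp only [_root_.add_apply, _root_.smul_apply, smul_eq_mul, fderiv_fderiv_apply hf]
    ring
  simp only [hterm] at hdiv
  have i1 : Integrable (fun x => ∑ j, ∑ k, fderiv ℝ (b j k) x (e j) * fderiv ℝ f x (e k))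
      (volume.restrict Ω) :=
    integrable_finsetSum _ fun j _ => integrable_finsetSum _ fun k _ =>
      (((contDiff_fderiv_apply (hb j k) (e j)).continuous.mul
        (hfk k).continuous).integrable_of_hasCompactSupport (hfc k).mul_left).restrict
  have i0 : Integrable (fun x => ∑ j, fderiv ℝ (fun y => ∑ k, b j k y * fderiv ℝ f y (e k)) x (e j))
      (volume.restrict Ω) :=
    integrable_finsetSum _ fun j _ =>
      ((contDiff_fderiv_apply (hF j) (e j)).continuous.integrable_of_hasCompactSupport
        ((hFc j).fderiv_apply ℝ (e j))).restrict
  have i2 : Integrable (fun x => ∑ j, ∑ k, a j k x * fderiv ℝ (fderiv ℝ f) x (e j) (e k))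
      (volume.restrict Ω) := by
    refine (i0.sub i1).congr (.of_forall fun x => ?_)
    simp only [Pi.sub_apply, hterm]
    ring
  rw [integral_add i2 i1] at hdiv
  exact eq_neg_of_add_eq_zero_left hdiv

theorem norm_jet_apply_le (Ω : Set (E N)) (f : testFunctions N) (a : Ord1 N) :
    ‖(memLp_partial1 Ω f a).toLp _‖ ≤ ‖jet Ω f‖ :=
  PiLp.norm_apply_le (p := 2) (jet Ω f) a

theorem exists_norm_integral_mul_partial1_le {w : E N → ℂ}
    (hw : MemLp w 2 (volume.restrict Ω)) (a : Ord1 N) :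
    ∃ C : ℝ, ∀ f : testFunctions N,
      ‖∫ x in Ω, w x * partial1 (f : E N → ℂ) a x‖ ≤ C * ‖jet Ω f‖ := by
  have hw' : MemLp (fun x => star (w x)) 2 (volume.restrict Ω) := hw.star
  refine ⟨‖hw'.toLp _‖, fun f => ?_⟩
  have h1 : ∫ x in Ω, w x * partial1 (f : E N → ℂ) a x
      = inner ℂ (hw'.toLp _) ((memLp_partial1 Ω f a).toLp _) := by
    rw [L2.inner_def]
    refine integral_congr_ae ?_
    filter_upwards [hw'.coeFn_toLp, (memLp_partial1 Ω f a).coeFn_toLp] with x h2 h3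
    rw [h2, h3, RCLike.inner_apply]
    simp [mul_comm]
  rw [h1]
  exact (norm_inner_le_norm _ _).trans
    (mul_le_mul_of_nonneg_left (norm_jet_apply_le Ω f a) (norm_nonneg _))

/-- Finite sums of functionals that are bounded by a given seminorm are bounded by it. -/
theorem exists_norm_sum_le {ι α : Type*} {s : Finset ι} {L : ι → α → ℂ} {m : α → ℝ}
    (h : ∀ i, ∃ C : ℝ, ∀ f, ‖L i f‖ ≤ C * m f) : ∃ C : ℝ, ∀ f, ‖∑ i ∈ s, L i f‖ ≤ C * m f := by
  choose C hC using h
  refine ⟨∑ i ∈ s, C i, fun f => (norm_sum_le _ _).trans ?_⟩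
  rw [Finset.sum_mul]
  exact Finset.sum_le_sum fun i _ => hC i f

theorem exists_norm_integral_second_order_le (hρ : IsDefiningFunction ρ Ω)
    {a b : Fin (N + 1) → Fin (N + 1) → E N → ℂ} (hb : ∀ j k, ContDiff ℝ ∞ (b j k))
    (hab : ∀ j k x, b j k x + b k j x = a j k x + a k j x)
    (ht : ∀ x ∈ frontier Ω, ∀ k, ∑ j, fderiv ℝ ρ x (e j) • b j k x = 0)
    (hL : ∀ j k, MemLp (fun x => fderiv ℝ (b j k) x (e j)) 2 (volume.restrict Ω)) :
    ∃ C : ℝ, ∀ f : testFunctions N,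
      ‖∫ x in Ω, ∑ j, ∑ k, a j k x * fderiv ℝ (fderiv ℝ (f : E N → ℂ)) x (e j) (e k)‖
        ≤ C * ‖jet Ω f‖ := by
  have h : ∀ f : testFunctions N,
      ∫ x in Ω, ∑ j, ∑ k, a j k x * fderiv ℝ (fderiv ℝ (f : E N → ℂ)) x (e j) (e k)
        = -∑ j, ∑ k, ∫ x in Ω, fderiv ℝ (b j k) x (e j) * partial1 (f : E N → ℂ) (some k) x := by
    intro f
    have hi : ∀ j k, Integrable
        (fun x => fderiv ℝ (b j k) x (e j) * partial1 (f : E N → ℂ) (some k) x)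
        (volume.restrict Ω) := fun j k =>
      (((contDiff_fderiv_apply (hb j k) (e j)).continuous.mul
        (contDiff_fderiv_apply f.2.1 (e k)).continuous).integrable_of_hasCompactSupport
          (f.2.2.fderiv_apply ℝ (e k)).mul_left).restrict
    rw [integral_second_order_eq hρ hb hab ht f.2]
    congr 1
    exact (integral_finsetSum _ fun j _ => integrable_finsetSum _ fun k _ => hi j k).trans
      (Finset.sum_congr rfl fun j _ => integral_finsetSum _ fun k _ => hi j k)
  simp only [h, norm_neg]
  exact exists_norm_sum_le fun j => exists_norm_sum_le fun k =>
    exists_norm_integral_mul_partial1_le (hL j k) (some k)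

/-! ### Boundary layers -/

theorem fderiv_exp_smul_apply (hρ : ContDiff ℝ ∞ ρ) {G : E N → V} (hG : ContDiff ℝ ∞ G) (l : ℝ)
    (x w : E N) :
    fderiv ℝ (fun y => Real.exp (l * ρ y) • G y) x w
      = Real.exp (l * ρ x) • ((l * fderiv ℝ ρ x w) • G x + fderiv ℝ G x w) := by
  have h1 : HasFDerivAt (fun y => Real.exp (l * ρ y))
      (Real.exp (l * ρ x) • l • fderiv ℝ ρ x) x :=
    (((hρ.differentiable (by simp) x).hasFDerivAt).const_mul l).exp
  have h2 := h1.smul (hG.differentiable (by simp) x).hasFDerivAt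
  have h3 : fderiv ℝ (fun y => Real.exp (l * ρ y) • G y) x = _ := h2.fderiv
  rw [h3]
  simp only [_root_.add_apply, _root_.smul_apply, ContinuousLinearMap.smulRight_apply, smul_eq_mul,
    smul_add, smul_smul]
  rw [add_comm, mul_assoc]

theorem tendsto_integral_exp_smul (hρ : IsDefiningFunction ρ Ω) {R : E N → V} (hR : Continuous R)
    (hc : HasCompactSupport R) :
    Tendsto (fun n : ℕ => ∫ x in Ω, Real.exp ((n + 1) * ρ x) • R x) atTop (𝓝 0) := by
  have h0 : (0 : V) = ∫ _ in Ω, (0 : V) := by simp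
  rw [h0]
  refine tendsto_integral_of_dominated_convergence (fun x => ‖R x‖) (fun n => ?_)
    (hR.integrable_of_hasCompactSupport hc).norm.restrict (fun n => ?_) ?_
  · have := hρ.contDiff.continuous
    exact Continuous.aestronglyMeasurable (by fun_prop)
  · filter_upwards [ae_restrict_mem hρ.isOpen.measurableSet] with x hx
    rw [norm_smul, Real.norm_of_nonneg (Real.exp_nonneg _)]
    refine mul_le_of_le_one_left (norm_nonneg _) (Real.exp_le_one_iff.2 ?_)
    exact mul_nonpos_of_nonneg_of_nonpos (by positivity) (hρ.mem_iff.1 hx).le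
  · filter_upwards [ae_restrict_mem hρ.isOpen.measurableSet] with x hx
    have h1 : Tendsto (fun n : ℕ => ((n : ℝ) + 1) * ρ x) atTop atBot :=
      (tendsto_atTop_add_const_right _ _ tendsto_natCast_atTop_atTop).atTop_mul_const_of_neg
        (hρ.mem_iff.1 hx)
    simpa using (Real.tendsto_exp_atBot.comp h1).smul_const (R x)

/-- `t ↦ exp (-1/t)` has derivative `t⁻² exp (-1/t)`. -/
theorem hasDerivAt_expNegInvGlue (t : ℝ) :
    HasDerivAt expNegInvGlue (t⁻¹ ^ 2 * expNegInvGlue t) t := by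
  have h := expNegInvGlue.hasDerivAt_polynomial_eval_inv_mul 1 t
  simpa using h

/-- Arbitrarily close to a boundary point `p` there are nonnegative bumps whose derivative along the
gradient at `p` has positive integral over `Ω`. They are radial about a point `q` beyond `p` on the
normal line through `p`, with radius twice the distance from `q` to `p`, so that the part of their
support in `Ω` lies on the inner side of the hyperplane through `q`, where they increase in the
direction of the gradient. -/
theorem exists_bump_increasing (hρ : IsDefiningFunction ρ Ω) {p : E N} (hp : p ∈ frontier Ω)
    {U : Set (E N)} (hU : U ∈ 𝓝 p) :
    ∃ b : E N → ℝ, ContDiff ℝ ∞ b ∧ HasCompactSupport b ∧ tsupport b ⊆ U ∧ (∀ x, 0 ≤ b x) ∧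
      0 < ∫ x in Ω, fderiv ℝ b x (gradient ρ p) := by
  set v := gradient ρ p with hv
  have hv0 : 0 < ‖v‖ := norm_pos_iff.2 (hρ.gradient_ne_zero p hp)
  have hd := (hρ.contDiff.differentiable (by simp) p).hasFDerivAt.isLittleO.def
    (show 0 < ‖v‖ / 4 by positivity)
  obtain ⟨δ, hδ, H⟩ := Metric.mem_nhds_iff.1 (Filter.inter_mem hU hd)
  -- `3 s ‖v‖` bounds the distance from `p` to the points of the support
  obtain ⟨s, hs0, hs⟩ : ∃ s : ℝ, 0 < s ∧ 3 * s * ‖v‖ < δ :=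
    ⟨δ / (4 * ‖v‖), by positivity, by field_simp; norm_num⟩
  set q := p + s • v with hq
  set r := 2 * s * ‖v‖ with hr
  have hr0 : 0 < r := by positivity
  have hqp : dist p q = s * ‖v‖ := by
    rw [hq, dist_self_add_right, norm_smul, Real.norm_of_nonneg hs0.le]
  have hball : ∀ x ∈ Metric.closedBall q r, dist x p ≤ 3 * s * ‖v‖ := by
    intro x hx
    have := dist_triangle x q p
    rw [dist_comm q p, hqp] at this
    have hx' : dist x q ≤ r := hx
    linarith
  have hside : ∀ x ∈ Metric.closedBall q r, x ∈ Ω → inner ℝ (x - q) v < 0 := by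
    intro x hx hxΩ
    have hxp := hball x hx
    have h1 : ‖ρ x - ρ p - fderiv ℝ ρ p (x - p)‖ ≤ ‖v‖ / 4 * ‖x - p‖ :=
      (H (Metric.mem_ball.2 (hxp.trans_lt hs))).2
    rw [hρ.eq_zero hp, fderiv_apply_gradient hρ, ← hv, Real.norm_eq_abs] at h1
    have h2 := (abs_le.1 h1).1
    have h3 := hρ.mem_iff.1 hxΩ
    rw [dist_eq_norm] at hxp
    have h4 : inner ℝ (x - q) v = inner ℝ v (x - p) - s * ‖v‖ ^ 2 := by
      rw [hq, ← sub_sub, inner_sub_left, real_inner_smul_left, real_inner_self_eq_norm_sq,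
        real_inner_comm]
    have h5 : ‖v‖ / 4 * ‖x - p‖ ≤ ‖v‖ / 4 * (3 * s * ‖v‖) := by gcongr
    have h6 : 0 < s * ‖v‖ ^ 2 := by positivity
    rw [h4]
    nlinarith
  set b : E N → ℝ := fun x => expNegInvGlue (r ^ 2 - ‖x - q‖ ^ 2) with hb
  have hbc : ContDiff ℝ ∞ b :=
    (expNegInvGlue.contDiff (n := ⊤)).comp
      (contDiff_const.sub ((contDiff_id.sub contDiff_const).norm_sq ℝ))
  have hb0 : ∀ x ∉ Metric.closedBall q r, b x = 0 := by
    intro x hx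
    rw [Metric.mem_closedBall, not_le, dist_eq_norm] at hx
    refine expNegInvGlue.zero_of_nonpos ?_
    nlinarith
  have hbs : tsupport b ⊆ Metric.closedBall q r :=
    closure_minimal (fun x hx => by_contra fun h => hx (hb0 x h)) Metric.isClosed_closedBall
  have hbcs : HasCompactSupport b := HasCompactSupport.intro (isCompact_closedBall q r) hb0
  have hb' : ∀ x, fderiv ℝ b x v
      = -2 * ((r ^ 2 - ‖x - q‖ ^ 2)⁻¹ ^ 2 * b x) * inner ℝ (x - q) v := by
    intro x
    have h1 : HasFDerivAt (fun y : E N => r ^ 2 - ‖y - q‖ ^ 2) (-(2 • innerSL ℝ (x - q))) x := by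
      have := ((hasFDerivAt_id x).sub_const q).norm_sq.const_sub (r ^ 2)
      simpa using this
    have h2 : fderiv ℝ b x = _ := ((hasDerivAt_expNegInvGlue _).comp_hasFDerivAt x h1).fderiv
    rw [h2]
    simp only [hb, _root_.smul_apply, _root_.neg_apply, innerSL_apply_apply, smul_eq_mul,
      nsmul_eq_mul]
    push_cast
    ring
  refine ⟨b, hbc, hbcs, fun x hx => ?_, fun x => expNegInvGlue.nonneg _, ?_⟩
  · exact (H (Metric.mem_ball.2 ((hball x (hbs hx)).trans_lt hs))).1
  have hint : Integrable (fun x => fderiv ℝ b x v) (volume.restrict Ω) :=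
    ((contDiff_fderiv_apply hbc v).continuous.integrable_of_hasCompactSupport
      (hbcs.fderiv_apply ℝ v)).restrict
  rw [setIntegral_pos_iff_support_of_nonneg_ae ?_ hint]
  · have hopen : IsOpen (Metric.ball q r ∩ Ω) := Metric.isOpen_ball.inter hρ.isOpen
    have hne : (Metric.ball q r ∩ Ω).Nonempty := by
      refine mem_closure_iff.1 hp.1 _ Metric.isOpen_ball ?_
      rw [Metric.mem_ball, hqp]
      have : 0 < s * ‖v‖ := by positivity
      linarith
    refine (hopen.measure_pos volume hne).trans_le (measure_mono ?_)
    rintro x ⟨hx, hxΩ⟩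
    refine ⟨?_, hxΩ⟩
    rw [Function.mem_support, hb']
    have h1 := (hside x (Metric.ball_subset_closedBall hx) hxΩ).ne
    rw [Metric.mem_ball, dist_eq_norm] at hx
    have h2 : 0 < r ^ 2 - ‖x - q‖ ^ 2 := by
      have := norm_nonneg (x - q)
      nlinarith
    have h3 : b x ≠ 0 := (expNegInvGlue.pos_of_pos h2).ne'
    have h4 := (inv_pos.2 h2).ne'
    simp [h1, h2.ne', h3]
  · filter_upwards [ae_restrict_mem hρ.isOpen.measurableSet] with x hxΩ
    by_cases hx : x ∈ Metric.closedBall q r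
    · rw [hb']
      have h1 := hside x hx hxΩ
      have h2 : 0 ≤ (r ^ 2 - ‖x - q‖ ^ 2)⁻¹ ^ 2 * b x :=
        mul_nonneg (sq_nonneg _) (expNegInvGlue.nonneg _)
      exact mul_nonneg_of_nonpos_of_nonpos (by linarith) h1.le
    · rw [hb', hb0 x hx]
      simp

/-- The measures `(n + 1) exp ((n + 1) ρ) dV` on `Ω` do not lose their mass near `p`. -/
theorem exists_bump_integral_exp_ge (hρ : IsDefiningFunction ρ Ω) {p : E N} (hp : p ∈ frontier Ω)
    {U : Set (E N)} (hU : U ∈ 𝓝 p) :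
    ∃ b : E N → ℝ, ContDiff ℝ ∞ b ∧ HasCompactSupport b ∧ tsupport b ⊆ U ∧ (∀ x, 0 ≤ b x) ∧
      ∃ δ > 0, ∀ᶠ n : ℕ in atTop,
        δ ≤ ∫ x in Ω, ((n : ℝ) + 1) * (Real.exp ((n + 1) * ρ x) * b x) := by
  obtain ⟨b, hb, hbc, hbU, hb0, hpos⟩ := exists_bump_increasing hρ hp hU
  refine ⟨b, hb, hbc, hbU, hb0, ?_⟩
  set v := gradient ρ p with hv
  set I := ∫ x in Ω, fderiv ℝ b x v with hI
  have hρv : Continuous fun x => fderiv ℝ ρ x v := (contDiff_fderiv_apply hρ.contDiff v).continuous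
  obtain ⟨C, hC⟩ := hbc.isCompact.exists_bound_of_continuousOn hρv.continuousOn
  set D := max C 1 with hD
  have hD0 : 0 < D := lt_of_lt_of_le one_pos (le_max_right _ _)
  have hexp : ∀ n : ℕ, ContDiff ℝ ∞ fun x => Real.exp ((n + 1) * ρ x) := fun n =>
    (contDiff_const.mul hρ.contDiff).exp
  have hbv : Continuous fun x => fderiv ℝ b x v := (contDiff_fderiv_apply hb v).continuous
  have hbvc : HasCompactSupport fun x => fderiv ℝ b x v := hbc.fderiv_apply ℝ v
  -- `(1 - exp ((n + 1) ρ)) b v` vanishes on the boundary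
  have hdiv : ∀ n : ℕ, ∫ x in Ω, ((n : ℝ) + 1) * (Real.exp ((n + 1) * ρ x) * (fderiv ℝ ρ x v * b x))
      = I - ∫ x in Ω, Real.exp ((n + 1) * ρ x) • fderiv ℝ b x v := by
    intro n
    set G : E N → ℝ := fun x => b x - Real.exp ((n + 1) * ρ x) • b x with hG
    have hG1 : ContDiff ℝ ∞ G := hb.sub ((hexp n).smul hb)
    have hG2 : ContDiff ℝ 1 G := hG1.of_le (mod_cast le_top)
    have hGc : HasCompactSupport G := hbc.sub (hbc.smul_left (f := fun x => Real.exp ((n + 1) * ρ x)))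
    have h := integral_divergence_eq_zero hρ (F := fun j x => v j • G x)
      (fun j => contDiff_const.fun_smul hG2) (fun j => hGc.smul_left (f := fun _ => v j))
      (by
        intro x hx
        simp [hG, hρ.eq_zero hx])
    have hG' : ∀ x, ∑ j, fderiv ℝ (fun y => v j • G y) x (e j)
        = fderiv ℝ b x v - Real.exp ((n + 1) * ρ x) • fderiv ℝ b x v
          - ((n : ℝ) + 1) * (Real.exp ((n + 1) * ρ x) * (fderiv ℝ ρ x v * b x)) := by
      intro x
      have h1 : ∀ j, fderiv ℝ (fun y => v j • G y) x (e j) = v j • fderiv ℝ G x (e j) := by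
        intro j
        rw [fderiv_fun_const_smul (hG1.differentiable (by simp) x)]
        rfl
      simp only [h1]
      have h2 := map_eq_sum_coord (fderiv ℝ G x).toLinearMap v
      simp only [ContinuousLinearMap.coe_coe] at h2
      rw [← h2, hG, fderiv_fun_sub (hb.differentiable (by simp) x)
        (((hexp n).fun_smul hb).differentiable (by simp) x), _root_.sub_apply,
        fderiv_exp_smul_apply hρ.contDiff hb]
      simp only [smul_eq_mul]
      ring
    simp only [hG'] at h
    have i1 : Integrable (fun x => fderiv ℝ b x v) (volume.restrict Ω) :=
      (hbv.integrable_of_hasCompactSupport hbvc).restrict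
    have i2 : Integrable (fun x => Real.exp ((n + 1) * ρ x) • fderiv ℝ b x v)
        (volume.restrict Ω) :=
      (((hexp n).continuous.smul hbv).integrable_of_hasCompactSupport hbvc.smul_left).restrict
    have i3 : Integrable
        (fun x => ((n : ℝ) + 1) * (Real.exp ((n + 1) * ρ x) * (fderiv ℝ ρ x v * b x)))
        (volume.restrict Ω) :=
      ((continuous_const.mul ((hexp n).continuous.mul
        (hρv.mul hb.continuous))).integrable_of_hasCompactSupport
          hbc.mul_left.mul_left.mul_left).restrict
    have i4 : Integrable (fun x => fderiv ℝ b x v - Real.exp ((n + 1) * ρ x) • fderiv ℝ b x v)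
        (volume.restrict Ω) := i1.sub i2
    rw [integral_sub i4 i3, integral_sub i1 i2] at h
    linarith
  have hlim := (tendsto_integral_exp_smul hρ hbv hbvc).const_sub I
  rw [sub_zero] at hlim
  refine ⟨I / 2 / D, by positivity, ?_⟩
  filter_upwards [hlim.eventually_const_lt (half_lt_self hpos)] with n hn
  rw [← hdiv] at hn
  rw [div_le_iff₀' hD0, ← integral_const_mul]
  refine hn.le.trans (integral_mono ?_ ?_ fun x => ?_)
  · exact ((continuous_const.mul ((hexp n).continuous.mul
        (hρv.mul hb.continuous))).integrable_of_hasCompactSupport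
          hbc.mul_left.mul_left.mul_left).restrict
  · exact ((continuous_const.mul (continuous_const.mul ((hexp n).continuous.mul
        hb.continuous))).integrable_of_hasCompactSupport
          hbc.mul_left.mul_left.mul_left).restrict
  · by_cases hx : x ∈ tsupport b
    · have h1 : fderiv ℝ ρ x v ≤ D := (le_abs_self _).trans ((hC x hx).trans (le_max_left _ _))
      have h2 := hb0 x
      have h3 := Real.exp_nonneg ((n + 1) * ρ x)
      calc ((n : ℝ) + 1) * (Real.exp ((n + 1) * ρ x) * (fderiv ℝ ρ x v * b x))
          ≤ ((n : ℝ) + 1) * (Real.exp ((n + 1) * ρ x) * (D * b x)) := by gcongr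
        _ = D * (((n : ℝ) + 1) * (Real.exp ((n + 1) * ρ x) * b x)) := by ring
    · simp [image_eq_zero_of_notMem_tsupport hx]

theorem norm_toLp_sq {μ : Measure (E N)} {f : E N → ℂ} (hf : MemLp f 2 μ) :
    ‖hf.toLp f‖ ^ 2 = ∫ x, ‖f x‖ ^ 2 ∂μ := by
  have h : inner ℂ (hf.toLp f) (hf.toLp f) = ((∫ x, ‖f x‖ ^ 2 ∂μ : ℝ) : ℂ) := by
    rw [L2.inner_def, ← integral_complex_ofReal]
    refine integral_congr_ae ?_
    filter_upwards [hf.coeFn_toLp] with x hx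
    rw [hx, inner_self_eq_norm_sq_to_K]
    simp
  rw [inner_self_eq_norm_sq_to_K] at h
  exact Complex.ofReal_injective (by simpa using h)

theorem norm_jet_sq (Ω : Set (E N)) (f : testFunctions N) :
    ‖jet Ω f‖ ^ 2 = ∑ a, ∫ x in Ω, ‖partial1 (f : E N → ℂ) a x‖ ^ 2 := by
  rw [PiLp.norm_sq_eq_of_L2]
  exact Finset.sum_congr rfl fun a _ => norm_toLp_sq (memLp_partial1 Ω f a)

theorem integrable_exp_smul (hρ : ContDiff ℝ ∞ ρ) {R : E N → V} (hR : Continuous R)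
    (hc : HasCompactSupport R) (n : ℕ) :
    Integrable (fun x => Real.exp (((n : ℝ) + 1) * ρ x) • R x) (volume.restrict Ω) := by
  have hexp : Continuous fun x => Real.exp (((n : ℝ) + 1) * ρ x) :=
    Real.continuous_exp.comp (continuous_const.mul hρ.continuous)
  exact ((hexp.smul hR).integrable_of_hasCompactSupport
    (hc.smul_left (f := fun x => Real.exp (((n : ℝ) + 1) * ρ x)))).restrict

/-- The function `l⁻¹ exp (l ρ) g` with `l = n + 1`. Its first derivatives tend to zero in `L²(Ω)`,
whereas its second normal derivative concentrates on the boundary. -/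
def boundaryLayer (ρ : E N → ℝ) (g : E N → ℂ) (n : ℕ) : E N → ℂ := fun x =>
  Real.exp (((n : ℝ) + 1) * ρ x) • ((n : ℝ) + 1)⁻¹ • g x

theorem boundaryLayer_mem (hρ : ContDiff ℝ ∞ ρ) {g : E N → ℂ} (hg : g ∈ testFunctions N) (n : ℕ) :
    boundaryLayer ρ g n ∈ testFunctions N := by
  refine ⟨(contDiff_const.mul hρ).exp.smul (contDiff_const.fun_smul hg.1), ?_⟩
  exact (hg.2.smul_left (f := fun _ => ((n : ℝ) + 1)⁻¹)).smul_left
    (f := fun x => Real.exp (((n : ℝ) + 1) * ρ x))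

theorem fderiv_boundaryLayer (hρ : ContDiff ℝ ∞ ρ) {g : E N → ℂ} (hg : ContDiff ℝ ∞ g) (n : ℕ)
    (x w : E N) :
    fderiv ℝ (boundaryLayer ρ g n) x w = Real.exp (((n : ℝ) + 1) * ρ x) •
      (fderiv ℝ ρ x w • g x + ((n : ℝ) + 1)⁻¹ • fderiv ℝ g x w) := by
  unfold boundaryLayer
  rw [fderiv_exp_smul_apply (G := fun y => ((n : ℝ) + 1)⁻¹ • g y) hρ (contDiff_const.fun_smul hg),
    fderiv_fun_const_smul (hg.differentiable (by simp) x)]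
  congr 2
  rw [smul_smul]
  congr 1
  have : (n : ℝ) + 1 ≠ 0 := by positivity
  field_simp

theorem fderiv_fderiv_boundaryLayer (hρ : ContDiff ℝ ∞ ρ) {g : E N → ℂ} (hg : ContDiff ℝ ∞ g)
    (n : ℕ) (x z w : E N) :
    fderiv ℝ (fderiv ℝ (boundaryLayer ρ g n)) x z w = Real.exp (((n : ℝ) + 1) * ρ x) •
      (((n : ℝ) + 1) • (fderiv ℝ ρ x z * fderiv ℝ ρ x w) • g x
        + (fderiv ℝ ρ x z • fderiv ℝ g x w + fderiv ℝ (fun y => fderiv ℝ ρ y w • g y) x z)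
        + ((n : ℝ) + 1)⁻¹ • fderiv ℝ (fun y => fderiv ℝ g y w) x z) := by
  have hf : ContDiff ℝ ∞ (boundaryLayer ρ g n) :=
    (contDiff_const.mul hρ).exp.smul (contDiff_const.fun_smul hg)
  have h1 : ContDiff ℝ ∞ fun y => fderiv ℝ ρ y w • g y := (contDiff_fderiv_apply hρ w).smul hg
  have h2 : ContDiff ℝ ∞ fun y => fderiv ℝ g y w := contDiff_fderiv_apply hg w
  rw [← fderiv_fderiv_apply hf]
  simp only [fderiv_boundaryLayer hρ hg]
  rw [fderiv_exp_smul_apply (G := fun y => fderiv ℝ ρ y w • g y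
      + ((n : ℝ) + 1)⁻¹ • fderiv ℝ g y w) hρ (h1.add (contDiff_const.fun_smul h2)),
    fderiv_fun_add (h1.differentiable (by simp) x)
      ((contDiff_const.fun_smul h2).differentiable (by simp) x),
    fderiv_fun_const_smul (h2.differentiable (by simp) x)]
  simp only [_root_.add_apply, _root_.smul_apply]
  congr 1
  have : (n : ℝ) + 1 ≠ 0 := by positivity
  simp only [smul_add, smul_smul]
  have h3 : ((n : ℝ) + 1) * fderiv ℝ ρ x z * ((n : ℝ) + 1)⁻¹ = fderiv ℝ ρ x z := by field_simp
  rw [h3, mul_assoc]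
  abel

theorem tendsto_norm_jet_boundaryLayer (hρ : IsDefiningFunction ρ Ω) {g : E N → ℂ}
    (hg : g ∈ testFunctions N) :
    Tendsto (fun n => ‖jet Ω ⟨boundaryLayer ρ g n, boundaryLayer_mem hρ.contDiff hg n⟩‖) atTop
      (𝓝 0) := by
  have hsq : Tendsto (fun n => ‖jet Ω ⟨boundaryLayer ρ g n, boundaryLayer_mem hρ.contDiff hg n⟩‖ ^ 2)
      atTop (𝓝 0) := by
    simp only [norm_jet_sq]
    have h0 : (0 : ℝ) = ∑ _ : Ord1 N, 0 := by simp
    rw [h0]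
    refine tendsto_finsetSum _ fun a _ => ?_
    -- a bound for `exp (-l ρ)` times the derivative, uniform in `l`
    obtain ⟨m, hm, hmc, hma⟩ : ∃ m : E N → ℝ, Continuous m ∧ HasCompactSupport m ∧ ∀ n x,
        ‖partial1 (boundaryLayer ρ g n) a x‖ ≤ Real.exp (((n : ℝ) + 1) * ρ x) * m x := by
      have hl : ∀ n : ℕ, ‖((n : ℝ) + 1)⁻¹‖ ≤ 1 := fun n => by
        rw [norm_inv, Real.norm_of_nonneg (by positivity)]
        exact inv_le_one_of_one_le₀ (by simp)
      cases a with
      | none =>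
        refine ⟨fun x => ‖g x‖, hg.1.continuous.norm, hg.2.norm, fun n x => ?_⟩
        simp only [partial1, boundaryLayer]
        rw [norm_smul, norm_smul, Real.norm_of_nonneg (Real.exp_nonneg _)]
        gcongr
        exact mul_le_of_le_one_left (norm_nonneg _) (hl n)
      | some k =>
        refine ⟨fun x => ‖fderiv ℝ ρ x (e k) • g x‖ + ‖fderiv ℝ g x (e k)‖, ?_, ?_, fun n x => ?_⟩
        · exact (((contDiff_fderiv_apply hρ.contDiff (e k)).continuous.smul
            hg.1.continuous).norm).add (contDiff_fderiv_apply hg.1 (e k)).continuous.norm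
        · exact (hg.2.smul_left (f := fun x => fderiv ℝ ρ x (e k))).norm.add
            (hg.2.fderiv_apply ℝ (e k)).norm
        · simp only [partial1]
          rw [fderiv_boundaryLayer hρ.contDiff hg.1, norm_smul,
            Real.norm_of_nonneg (Real.exp_nonneg _)]
          gcongr
          refine (norm_add_le _ _).trans ?_
          gcongr
          rw [norm_smul]
          exact mul_le_of_le_one_left (norm_nonneg _) (hl n)
    have hm2c : HasCompactSupport fun x => m x ^ 2 := by
      have : (fun x => m x ^ 2) = fun x => m x * m x := by
        funext x
        ring
      rw [this]
      exact hmc.mul_left (f := m)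
    refine squeeze_zero (fun n => integral_nonneg fun x => by positivity) (fun n => ?_)
      (tendsto_integral_exp_smul hρ (hm.pow 2) hm2c)
    refine integral_mono_of_nonneg (.of_forall fun x => by positivity) ?_ ?_
    · have := hρ.contDiff.continuous
      exact (Continuous.integrable_of_hasCompactSupport (by fun_prop)
        (hm2c.smul_left (f := fun x => Real.exp (((n : ℝ) + 1) * ρ x)))).restrict
    · filter_upwards [ae_restrict_mem hρ.isOpen.measurableSet] with x hx
      have h1 : Real.exp (((n : ℝ) + 1) * ρ x) ≤ 1 := Real.exp_le_one_iff.2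
        (mul_nonpos_of_nonneg_of_nonpos (by positivity) (hρ.mem_iff.1 hx).le)
      have h2 := Real.exp_nonneg (((n : ℝ) + 1) * ρ x)
      calc ‖partial1 (boundaryLayer ρ g n) a x‖ ^ 2
          ≤ (Real.exp (((n : ℝ) + 1) * ρ x) * m x) ^ 2 := by
            gcongr
            exact hma n x
        _ = Real.exp (((n : ℝ) + 1) * ρ x) * (Real.exp (((n : ℝ) + 1) * ρ x) * m x ^ 2) := by ring
        _ ≤ 1 * (Real.exp (((n : ℝ) + 1) * ρ x) * m x ^ 2) := by gcongr
        _ = _ := by simp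
  have := hsq.sqrt
  simpa using this

/-- The leading term of a bounded second order functional on boundary layers tends to zero, since
the other terms do. -/
theorem tendsto_integral_normal_component (hρ : IsDefiningFunction ρ Ω)
    {a : Fin (N + 1) → Fin (N + 1) → E N → ℂ} {c : Fin (N + 1) → E N → ℂ}
    (ha : ∀ j k, Continuous (a j k)) (hc : ∀ k, Continuous (c k)) {C : ℝ}
    (hC : ∀ f : testFunctions N, ‖∫ x in Ω, (∑ k, c k x * fderiv ℝ (f : E N → ℂ) x (e k)
      + ∑ j, ∑ k, a j k x * fderiv ℝ (fderiv ℝ (f : E N → ℂ)) x (e j) (e k))‖ ≤ C * ‖jet Ω f‖)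
    {g : E N → ℂ} (hg : g ∈ testFunctions N) :
    Tendsto (fun n : ℕ => ∫ x in Ω, Real.exp (((n : ℝ) + 1) * ρ x) • ((n : ℝ) + 1) •
      ((∑ j, ∑ k, (fderiv ℝ ρ x (e j) * fderiv ℝ ρ x (e k)) • a j k x) * g x)) atTop (𝓝 0) := by
  set A : E N → ℂ := fun x => ∑ j, ∑ k, (fderiv ℝ ρ x (e j) * fderiv ℝ ρ x (e k)) • a j k x with hA
  have hρ' : ∀ k, Continuous fun x => fderiv ℝ ρ x (e k) := fun k =>
    (contDiff_fderiv_apply hρ.contDiff (e k)).continuous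
  have hAc : Continuous A := continuous_finsetSum _ fun j _ => continuous_finsetSum _ fun k _ =>
    ((hρ' j).mul (hρ' k)).smul (ha j k)
  change Tendsto (fun n : ℕ =>
    ∫ x in Ω, Real.exp (((n : ℝ) + 1) * ρ x) • ((n : ℝ) + 1) • (A x * g x)) atTop (𝓝 0)
  have hgk : ∀ k, Continuous fun x => fderiv ℝ g x (e k) := fun k =>
    (contDiff_fderiv_apply hg.1 (e k)).continuous
  have hgkc : ∀ k, HasCompactSupport fun x => fderiv ℝ g x (e k) := fun k =>
    hg.2.fderiv_apply ℝ (e k)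
  have hR : ∀ k, ContDiff ℝ ∞ fun y => fderiv ℝ ρ y (e k) • g y := fun k =>
    (contDiff_fderiv_apply hρ.contDiff (e k)).smul hg.1
  have hRc : ∀ k, HasCompactSupport fun y => fderiv ℝ ρ y (e k) • g y := fun k =>
    hg.2.smul_left (f := fun x => fderiv ℝ ρ x (e k))
  set P : E N → ℂ := fun x => ∑ k, c k x * (fderiv ℝ ρ x (e k) • g x)
    + ∑ j, ∑ k, a j k x * (fderiv ℝ ρ x (e j) • fderiv ℝ g x (e k)
      + fderiv ℝ (fun y => fderiv ℝ ρ y (e k) • g y) x (e j)) with hP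
  set Q : E N → ℂ := fun x => ∑ k, c k x * fderiv ℝ g x (e k)
    + ∑ j, ∑ k, a j k x * fderiv ℝ (fun y => fderiv ℝ g y (e k)) x (e j) with hQ
  have hPc : Continuous P := by
    refine (continuous_finsetSum _ fun k _ => (hc k).mul (hR k).continuous).add
      (continuous_finsetSum _ fun j _ => continuous_finsetSum _ fun k _ => (ha j k).mul ?_)
    exact ((hρ' j).smul (hgk k)).add (contDiff_fderiv_apply (hR k) (e j)).continuous
  have hQc : Continuous Q := by
    refine (continuous_finsetSum _ fun k _ => (hc k).mul (hgk k)).add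
      (continuous_finsetSum _ fun j _ => continuous_finsetSum _ fun k _ => (ha j k).mul ?_)
    exact (contDiff_fderiv_apply (contDiff_fderiv_apply hg.1 (e k)) (e j)).continuous
  have hz : ∀ x ∉ tsupport g, g =ᶠ[𝓝 x] fun _ => 0 := fun x hx => by
    filter_upwards [(isClosed_tsupport g).isOpen_compl.mem_nhds hx] with y hy
    exact image_eq_zero_of_notMem_tsupport hy
  have hz1 : ∀ x ∉ tsupport g, ∀ w, (fun y => fderiv ℝ g y w) =ᶠ[𝓝 x] fun _ => 0 := by
    intro x hx w
    filter_upwards [(isClosed_tsupport g).isOpen_compl.mem_nhds hx] with y hy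
    rw [(hz y hy).fderiv_eq, fderiv_const_apply]
    rfl
  have hPs : HasCompactSupport P := by
    refine HasCompactSupport.intro hg.2 fun x hx => ?_
    have h1 : ∀ k, (fun y => fderiv ℝ ρ y (e k) • g y) =ᶠ[𝓝 x] fun _ => 0 := fun k => by
      filter_upwards [hz x hx] with y hy
      rw [hy, smul_zero]
    simp only [hP, (h1 _).fderiv_eq, (hz x hx).fderiv_eq, (hz x hx).self_of_nhds]
    simp
  have hQs : HasCompactSupport Q := by
    refine HasCompactSupport.intro hg.2 fun x hx => ?_
    simp only [hQ, (hz1 x hx _).fderiv_eq, (hz x hx).fderiv_eq]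
    simp
  have h1 := tendsto_integral_exp_smul hρ hPc hPs
  have h2 := tendsto_integral_exp_smul hρ hQc hQs
  have hl : Tendsto (fun n : ℕ => ((n : ℝ) + 1)⁻¹) atTop (𝓝 0) :=
    tendsto_inv_atTop_zero.comp (tendsto_atTop_add_const_right _ _ tendsto_natCast_atTop_atTop)
  have h3 := hl.smul h2
  have h4 : Tendsto (fun n => ∫ x in Ω,
      (∑ k, c k x * fderiv ℝ (boundaryLayer ρ g n) x (e k)
        + ∑ j, ∑ k, a j k x * fderiv ℝ (fderiv ℝ (boundaryLayer ρ g n)) x (e j) (e k)))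
      atTop (𝓝 0) := by
    refine squeeze_zero_norm (fun n => hC ⟨_, boundaryLayer_mem hρ.contDiff hg n⟩) ?_
    simpa using (tendsto_norm_jet_boundaryLayer hρ hg).const_mul C
  have h5 := (h4.sub h1).sub h3
  simp only [smul_zero, sub_zero] at h5
  refine h5.congr fun n => ?_
  have hexpand : ∀ x, ∑ k, c k x * fderiv ℝ (boundaryLayer ρ g n) x (e k)
        + ∑ j, ∑ k, a j k x * fderiv ℝ (fderiv ℝ (boundaryLayer ρ g n)) x (e j) (e k)
      = Real.exp (((n : ℝ) + 1) * ρ x) • ((n : ℝ) + 1) • (A x * g x)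
        + Real.exp (((n : ℝ) + 1) * ρ x) • P x
        + ((n : ℝ) + 1)⁻¹ • Real.exp (((n : ℝ) + 1) * ρ x) • Q x := by
    intro x
    simp only [fderiv_boundaryLayer hρ.contDiff hg.1, fderiv_fderiv_boundaryLayer hρ.contDiff hg.1,
      hA, hP, hQ, Complex.real_smul, Finset.mul_sum, Finset.sum_mul, mul_add,
      Finset.sum_add_distrib]
    push_cast
    simp only [mul_comm, mul_left_comm]
    ring
  have i1 := integrable_exp_smul (Ω := Ω) hρ.contDiff (R := fun x => ((n : ℝ) + 1) • (A x * g x))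
    (by have := hg.1.continuous; fun_prop) (HasCompactSupport.intro hg.2 fun x hx => by
      simp [image_eq_zero_of_notMem_tsupport hx]) n
  have i2 := integrable_exp_smul (Ω := Ω) hρ.contDiff hPc hPs n
  have i4 : Integrable (fun x => Real.exp (((n : ℝ) + 1) * ρ x) • ((n : ℝ) + 1) • (A x * g x)
      + Real.exp (((n : ℝ) + 1) * ρ x) • P x) (volume.restrict Ω) := i1.add i2
  have i5 : Integrable (fun x => ((n : ℝ) + 1)⁻¹ • Real.exp (((n : ℝ) + 1) * ρ x) • Q x)
      (volume.restrict Ω) := (integrable_exp_smul hρ.contDiff hQc hQs n).smul (((n : ℝ) + 1)⁻¹)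
  rw [integral_congr_ae (.of_forall hexpand), integral_add i4 i5, integral_add i1 i2,
    integral_smul]
  abel

/-- A second order functional that is bounded in the `W¹` norm has vanishing normal component on the
boundary. It is tested on boundary layers. -/
theorem sum_normal_component_eq_zero (hρ : IsDefiningFunction ρ Ω)
    {a : Fin (N + 1) → Fin (N + 1) → E N → ℂ} {c : Fin (N + 1) → E N → ℂ}
    (ha : ∀ j k, Continuous (a j k)) (hc : ∀ k, Continuous (c k)) {C : ℝ}
    (hC : ∀ f : testFunctions N, ‖∫ x in Ω, (∑ k, c k x * fderiv ℝ (f : E N → ℂ) x (e k)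
      + ∑ j, ∑ k, a j k x * fderiv ℝ (fderiv ℝ (f : E N → ℂ)) x (e j) (e k))‖ ≤ C * ‖jet Ω f‖)
    {p : E N} (hp : p ∈ frontier Ω) :
    ∑ j, ∑ k, (fderiv ℝ ρ p (e j) * fderiv ℝ ρ p (e k)) • a j k p = 0 := by
  set A : E N → ℂ := fun x => ∑ j, ∑ k, (fderiv ℝ ρ x (e j) * fderiv ℝ ρ x (e k)) • a j k x with hA
  have hρ' : ∀ k, Continuous fun x => fderiv ℝ ρ x (e k) := fun k =>
    (contDiff_fderiv_apply hρ.contDiff (e k)).continuous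
  have hAc : Continuous A := continuous_finsetSum _ fun j _ => continuous_finsetSum _ fun k _ =>
    ((hρ' j).mul (hρ' k)).smul (ha j k)
  by_contra hne
  change A p ≠ 0 at hne
  have hpos : 0 < ‖A p‖ ^ 2 := by positivity
  -- a neighbourhood of `p` in which `A` has a definite direction
  have hU : {x | ‖A p‖ ^ 2 / 2 < (A x * star (A p)).re} ∈ 𝓝 p := by
    refine (isOpen_lt continuous_const
      (Complex.continuous_re.comp (hAc.mul continuous_const))).mem_nhds ?_
    have h1 : (A p * star (A p)).re = ‖A p‖ ^ 2 := by
      rw [Complex.star_def, Complex.mul_conj, Complex.ofReal_re, Complex.normSq_eq_norm_sq]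
    change ‖A p‖ ^ 2 / 2 < (A p * star (A p)).re
    rw [h1]
    exact half_lt_self hpos
  obtain ⟨b, hb, hbc, hbU, hb0, δ, hδ, hev⟩ := exists_bump_integral_exp_ge hρ hp hU
  set g : E N → ℂ := fun x => star (A p) * (b x : ℂ) with hgdef
  have hg : g ∈ testFunctions N := by
    refine ⟨contDiff_const.mul (Complex.ofRealCLM.contDiff.comp hb), ?_⟩
    exact (hbc.comp_left (g := fun t : ℝ => (t : ℂ)) (by simp)).mul_left
  have hre := (Complex.continuous_re.tendsto _).comp (tendsto_integral_normal_component hρ ha hc hC hg)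
  rw [Complex.zero_re] at hre
  have hlt : 0 < ‖A p‖ ^ 2 / 2 * δ := by positivity
  obtain ⟨n, hn1, hn2⟩ := ((hre.eventually_lt_const hlt).and hev).exists
  have i1 := integrable_exp_smul (Ω := Ω) hρ.contDiff (R := fun x => ((n : ℝ) + 1) • (A x * g x))
    (by have := hg.1.continuous; fun_prop) (HasCompactSupport.intro hg.2 fun x hx => by
      simp [image_eq_zero_of_notMem_tsupport hx]) n
  have i2 : Integrable (fun x => ((n : ℝ) + 1) * (Real.exp (((n : ℝ) + 1) * ρ x) * b x))
      (volume.restrict Ω) :=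
    (integrable_exp_smul hρ.contDiff hb.continuous hbc n).const_mul _
  have h1 : ‖A p‖ ^ 2 / 2 * δ ≤
      (∫ x in Ω, Real.exp (((n : ℝ) + 1) * ρ x) • ((n : ℝ) + 1) • (A x * g x)).re := by
    have h2 := integral_re (𝕜 := ℂ) i1
    change _ = Complex.re _ at h2
    rw [← h2]
    calc ‖A p‖ ^ 2 / 2 * δ
        ≤ ‖A p‖ ^ 2 / 2 * ∫ x in Ω, ((n : ℝ) + 1) * (Real.exp (((n : ℝ) + 1) * ρ x) * b x) := by
          gcongr
      _ = ∫ x in Ω, ‖A p‖ ^ 2 / 2 * (((n : ℝ) + 1) * (Real.exp (((n : ℝ) + 1) * ρ x) * b x)) :=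
          (integral_const_mul _ _).symm
      _ ≤ _ := by
          refine integral_mono (i2.const_mul _) i1.re fun x => ?_
          have h3 : RCLike.re (Real.exp (((n : ℝ) + 1) * ρ x) • ((n : ℝ) + 1) • (A x * g x))
              = (A x * star (A p)).re * (((n : ℝ) + 1) * (Real.exp (((n : ℝ) + 1) * ρ x) * b x)) := by
            have h4 : A x * g x = (b x) • (A x * star (A p)) := by
              simp only [hgdef, Complex.real_smul]
              ring
            rw [h4]
            change Complex.re _ = _
            simp only [Complex.smul_re, smul_eq_mul]
            ring
          rw [h3]
          by_cases hx : x ∈ tsupport b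
          · have h5 : ‖A p‖ ^ 2 / 2 < (A x * star (A p)).re := hbU hx
            have h6 := hb0 x
            gcongr
          · simp [image_eq_zero_of_notMem_tsupport hx]
  exact absurd hn1 (not_lt.2 h1)

end Analysis

section Forms

variable {N q : ℕ} {ρ : E N → ℝ} {Ω : Set (E N)}

/-! ### The exterior derivative and contractions -/

theorem contract_apply (η : E N [⋀^Fin (q + 1)]→L[ℝ] ℂ) (n : E N) (v : Fin q → E N) :
    contract η n v = η (Matrix.vecCons n v) := rfl

theorem range_removeAt (I : MultiIndex N (q + 1)) (i : Fin (q + 1)) :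
    range ((Fin.succAboveOrderEmb i).trans I) = range I \ {I i} := by
  have h : ⇑((Fin.succAboveOrderEmb i).trans I) = I ∘ i.succAbove := rfl
  rw [h, range_comp, Fin.range_succAbove, compl_eq_univ_sdiff,
    image_sdiff I.injective, image_univ, image_singleton]

/-- Removing an entry from an increasing multi-index of length `q + 1` gives each pair of an
increasing multi-index `J` of length `q` and an index `k ∉ J` exactly once. -/
theorem sum_removeAt {M : Type*} [AddCommMonoid M] (g : MultiIndex N q → Fin (N + 1) → M)
    (hg : ∀ (J : MultiIndex N q) k, k ∈ range J → g J k = 0) :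
    ∑ I : MultiIndex N (q + 1), ∑ i, g ((Fin.succAboveOrderEmb i).trans I) (I i)
      = ∑ J : MultiIndex N q, ∑ k, g J k := by
  rw [← Finset.sum_product', ← Finset.sum_product']
  refine Finset.sum_of_injOn
    (fun z : MultiIndex N (q + 1) × Fin (q + 1) => ((Fin.succAboveOrderEmb z.2).trans z.1, z.1 z.2))
    ?_ (fun _ _ => by simp) ?_ (fun _ _ => rfl)
  · rintro ⟨I, i⟩ - ⟨I', i'⟩ - h
    simp only [Prod.mk.injEq] at h
    have h1 : range I = range I' := by
      have h2 := range_removeAt I i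
      rw [h.1, range_removeAt, h.2] at h2
      have h3 : ∀ (K : MultiIndex N (q + 1)) (k), {K k} ⊆ range K := fun K k => by simp
      rw [← sdiff_union_of_subset (h3 I i), ← sdiff_union_of_subset (h3 I' i'), h.2, h2]
    have h4 : I = I' := OrderEmbedding.range_inj.1 h1
    subst h4
    exact Prod.ext rfl (I.injective h.2)
  · rintro ⟨J, k⟩ - hJk
    refine hg J k (by_contra fun hk => hJk ?_)
    have hcard : (insert k (Finset.univ.map J.toEmbedding)).card = q + 1 := by
      rw [Finset.card_insert_of_notMem (by simpa using hk)]
      simp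
    set I : MultiIndex N (q + 1) := Finset.orderEmbOfFin _ hcard with hI
    have hr : range I = insert k (range J) := by
      rw [hI, Finset.range_orderEmbOfFin]
      simp
    obtain ⟨i, hi⟩ : k ∈ range I := by
      rw [hr]
      exact mem_insert _ _
    refine ⟨(I, i), by simp, Prod.ext (OrderEmbedding.range_inj.1 ?_) hi⟩
    simp only
    rw [range_removeAt, hi, hr, insert_sdiff_of_mem _ (mem_singleton k), sdiff_singleton_eq_self hk]

/-- Pointwise, the exterior product with covectors is adjoint to the contraction. -/
theorem sum_star_mul_alternatizeUncurryFin (η : E N [⋀^Fin (q + 1)]→L[ℝ] ℂ)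
    (T : E N →L[ℝ] E N [⋀^Fin q]→L[ℝ] ℂ) :
    ∑ I : MultiIndex N (q + 1), star (η fun i => e (I i))
        * ContinuousAlternatingMap.alternatizeUncurryFin T (fun i => e (I i))
      = ∑ J : MultiIndex N q, ∑ k,
        star (contract η (e k) fun i => e (J i)) * T (e k) fun i => e (J i) := by
  refine Eq.trans ?_ (sum_removeAt (fun J k =>
    star (contract η (e k) fun i => e (J i)) * T (e k) fun i => e (J i)) ?_)
  · refine Finset.sum_congr rfl fun I _ => ?_
    rw [ContinuousAlternatingMap.alternatizeUncurryFin_apply, Finset.mul_sum]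
    refine Finset.sum_congr rfl fun i _ => ?_
    have h1 : (fun j => (e (((Fin.succAboveOrderEmb i).trans I) j) : E N))
        = i.removeNth fun j => e (I j) := rfl
    have h2 : η (fun j => e (I j)) = (-1) ^ (i : ℕ) •
        η (Matrix.vecCons (e (I i)) (i.removeNth fun j => e (I j))) := by
      rw [← ContinuousAlternatingMap.map_insertNth]
      congr 1
      exact (Fin.insertNth_self_removeNth i fun j => (e (I j) : E N)).symm
    rw [h1, contract_apply, h2]
    have h3 : ((-1 : ℂ) ^ (i : ℕ)) * (-1) ^ (i : ℕ) = 1 := by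
      rw [← mul_pow]
      simp
    simp only [zsmul_eq_mul, star_mul', star_pow, star_neg, star_one, Int.cast_pow, Int.cast_neg,
      Int.cast_one]
    linear_combination (star (η (Matrix.vecCons (e (I i)) (i.removeNth fun j => e (I j))))
      * T (e (I i)) (i.removeNth fun j => e (I j))) * h3
  · rintro J k ⟨j, rfl⟩
    have : contract η (e (J j)) (fun i => e (J i)) = 0 := by
      rw [contract_apply]
      exact η.map_eq_zero_of_eq _ (i := 0) (j := j.succ) (by simp) (Fin.succ_ne_zero j).symm
    rw [this, star_zero, zero_mul]

theorem fderiv_eval {φ : Form N q} (hφ : ContDiff ℝ ∞ φ) (v : Fin q → E N) (x w : E N) :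
    fderiv ℝ (fun y => φ y v) x w = fderiv ℝ φ x w v := by
  have h := (evalAt v).hasFDerivAt.comp x (hφ.differentiable (by simp) x).hasFDerivAt
  have h2 : fderiv ℝ (fun y => φ y v) x = (evalAt v).comp (fderiv ℝ φ x) := h.fderiv
  rw [h2]
  rfl

theorem contDiff_eval {φ : Form N q} (hφ : ContDiff ℝ ∞ φ) (v : Fin q → E N) :
    ContDiff ℝ ∞ fun y => φ y v :=
  (evalAt v).contDiff.comp hφ

theorem fderiv_fderiv_eval {φ : Form N q} (hφ : ContDiff ℝ ∞ φ) (v : Fin q → E N) (x z w : E N) :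
    fderiv ℝ (fderiv ℝ fun y => φ y v) x z w = fderiv ℝ (fderiv ℝ φ) x z w v := by
  rw [← fderiv_fderiv_apply (contDiff_eval hφ v), ← fderiv_fderiv_apply hφ]
  simp only [fderiv_eval hφ]
  exact fderiv_eval (contDiff_fderiv_apply hφ w) v x z

theorem fderiv_coeff_extDeriv {φ : Form N q} (hφ : ContDiff ℝ ∞ φ) (I : MultiIndex N (q + 1))
    (x w : E N) :
    fderiv ℝ (coeff (extDeriv φ) I) x w
      = ContinuousAlternatingMap.alternatizeUncurryFin (fderiv ℝ (fderiv ℝ φ) x w)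
        fun i => e (I i) := by
  have h1 : coeff (extDeriv φ) I = fun y => ∑ i : Fin (q + 1), (((-1) ^ (i : ℕ) : ℤ) : ℂ)
      * fderiv ℝ (fun z => φ z (i.removeNth fun j => e (I j))) y (e (I i)) := by
    funext y
    refine (extDeriv_apply (hφ.differentiable (by simp) y) _).trans ?_
    simp only [zsmul_eq_mul]
  have h2 : ∀ i : Fin (q + 1), ContDiff ℝ ∞
      fun y => fderiv ℝ (fun z => φ z (i.removeNth fun j => e (I j))) y (e (I i)) := fun i =>
    contDiff_fderiv_apply (contDiff_eval hφ _) _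
  rw [h1, fderiv_fun_sum fun i _ => ((h2 i).differentiable (by simp) x).const_mul _,
    _root_.sum_apply, ContinuousAlternatingMap.alternatizeUncurryFin_apply]
  refine Finset.sum_congr rfl fun i _ => ?_
  rw [fderiv_const_mul ((h2 i).differentiable (by simp) x), _root_.smul_apply,
    fderiv_fderiv_apply (contDiff_eval hφ _), fderiv_fderiv_eval hφ, zsmul_eq_mul, smul_eq_mul]

/-- The `W¹` inner product of `dφ` and `ψ` in terms of the contractions of `ψ` and of its
derivatives. -/
theorem inner_formClass_extD {u : W1Forms Ω (q + 1)} {ψ : Form N (q + 1)} (hψ : ContDiff ℝ ∞ ψ)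
    (hu : Represents u ψ) (φ : testForms N q) :
    inner ℂ u (formClass Ω (q + 1) (extD N q φ)) = ∫ x in Ω, ∑ J : MultiIndex N q,
      (∑ k, star (contract (ψ x) (e k) fun i => e (J i))
          * fderiv ℝ (coeff (φ : Form N q) J) x (e k)
        + ∑ j, ∑ k, star (contract (fderiv ℝ ψ x (e j)) (e k) fun i => e (J i))
          * fderiv ℝ (fderiv ℝ (coeff (φ : Form N q) J)) x (e j) (e k)) := by
  have hφ := φ.2.1
  have hpc : ∀ I a, Continuous (partial1 (coeff ψ I) a) := by
    intro I a
    cases a with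
    | none => exact (contDiff_eval hψ _).continuous
    | some j => exact (contDiff_fderiv_apply (contDiff_eval hψ _) (e j)).continuous
  have hint : ∀ I a, Integrable (fun x => star (partial1 (coeff ψ I) a x)
      * partial1 (coeff (extD N q φ : Form N (q + 1)) I) a x) (volume.restrict Ω) := by
    intro I a
    have hm := coeff_mem (extD N q φ) I
    refine (Continuous.integrable_of_hasCompactSupport ((hpc I a).star.mul ?_)
      (HasCompactSupport.mul_left ?_)).restrict
    · cases a with
      | none => exact hm.1.continuous
      | some j => exact (contDiff_fderiv_apply hm.1 (e j)).continuous
    · cases a with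
      | none => exact hm.2
      | some j => exact hm.2.fderiv_apply ℝ (e j)
  calc inner ℂ u (formClass Ω (q + 1) (extD N q φ))
      = ∑ I : MultiIndex N (q + 1), ∑ a : Ord1 N, ∫ x in Ω, star (partial1 (coeff ψ I) a x)
        * partial1 (coeff (extD N q φ : Form N (q + 1)) I) a x := by
        rw [W1Forms.inner_eq]
        refine Finset.sum_congr rfl fun I _ => Finset.sum_congr rfl fun a _ => ?_
        refine integral_congr_ae ?_
        filter_upwards [hu I a, represents_formClass Ω (q + 1) (extD N q φ) I a] with x h1 h2
        rw [h1, h2, RCLike.inner_apply, mul_comm]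
        rfl
    _ = ∫ x in Ω, ∑ I : MultiIndex N (q + 1), ∑ a : Ord1 N, star (partial1 (coeff ψ I) a x)
        * partial1 (coeff (extD N q φ : Form N (q + 1)) I) a x := by
        rw [integral_finsetSum _ fun I _ => integrable_finsetSum _ fun a _ => hint I a]
        exact Finset.sum_congr rfl fun I _ => (integral_finsetSum _ fun a _ => hint I a).symm
    _ = _ := by
        refine integral_congr_ae (.of_forall fun x => ?_)
        beta_reduce
        rw [Finset.sum_comm, Fintype.sum_option, Finset.sum_add_distrib]
        congr 1
        · refine (sum_star_mul_alternatizeUncurryFin (ψ x) (fderiv ℝ (φ : Form N q) x)).trans ?_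
          refine Finset.sum_congr rfl fun J _ => Finset.sum_congr rfl fun k _ => ?_
          rw [← fderiv_eval hφ]
          rfl
        · rw [Finset.sum_comm (s := (Finset.univ : Finset (MultiIndex N q)))]
          refine Finset.sum_congr rfl fun j _ => ?_
          have h1 : ∀ I : MultiIndex N (q + 1), partial1 (coeff ψ I) (some j) x
              = fderiv ℝ ψ x (e j) fun i => e (I i) := fun I => fderiv_eval hψ _ x (e j)
          have h2 : ∀ I : MultiIndex N (q + 1),
              partial1 (coeff (extD N q φ : Form N (q + 1)) I) (some j) x
              = ContinuousAlternatingMap.alternatizeUncurryFin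
                (fderiv ℝ (fderiv ℝ (φ : Form N q)) x (e j)) fun i => e (I i) := fun I =>
            fderiv_coeff_extDeriv hφ I x (e j)
          simp only [h1, h2]
          rw [sum_star_mul_alternatizeUncurryFin]
          refine Finset.sum_congr rfl fun J _ => Finset.sum_congr rfl fun k _ => ?_
          rw [← fderiv_fderiv_eval hφ]
          rfl

/-! ### Smooth elements of `W¹` -/

/-- A smooth function that is in `L²(Ω)` together with its first derivatives is in `W¹(Ω)`: the
truncations `χ (x / n) f` converge to it weakly, so it is orthogonal to everything that is orthogonal
to the test functions. -/
theorem toLp_mem_W1 {f : E N → ℂ} (hf : ContDiff ℝ ∞ f)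
    (hL : ∀ a, MemLp (partial1 f a) 2 (volume.restrict Ω)) :
    (WithLp.toLp 2 fun a => (hL a).toLp _ : L2Jets Ω) ∈ W1 Ω := by
  rw [W1, ← Submodule.orthogonal_orthogonal_eq_closure, Submodule.mem_orthogonal]
  intro w hw
  rw [Submodule.mem_orthogonal'] at hw
  obtain ⟨χ⟩ : Nonempty (ContDiffBump (0 : E N)) := inferInstance
  have hχ : ContDiff ℝ ∞ χ := χ.contDiff
  set s : ℕ → ℝ := fun n => ((n : ℝ) + 1)⁻¹ with hs
  have hs0 : ∀ n, s n ≠ 0 := fun n => by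
    simp only [hs]
    positivity
  have hs1 : ∀ n, |s n| ≤ 1 := fun n => by
    rw [abs_of_nonneg (by positivity)]
    exact inv_le_one_of_one_le₀ (by simp)
  have hslim : Tendsto s atTop (𝓝 0) :=
    tendsto_inv_atTop_zero.comp (tendsto_atTop_add_const_right _ _ tendsto_natCast_atTop_atTop)
  have hχs : ∀ n, ContDiff ℝ ∞ fun x : E N => χ (s n • x) := fun n =>
    hχ.comp (contDiff_id.const_smul (s n))
  have hmem : ∀ n, (fun x => χ (s n • x) • f x) ∈ testFunctions N := fun n => by
    refine ⟨(hχs n).smul hf, ?_⟩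
    exact (χ.hasCompactSupport.comp_homeomorph (Homeomorph.smulOfNeZero (s n) (hs0 n))).smul_right
  have hzero : ∀ n, ∑ a, ∫ x in Ω, inner ℂ (w a x)
      (partial1 (fun x => χ (s n • x) • f x) a x) = 0 := by
    intro n
    have h := hw (jet Ω ⟨_, hmem n⟩) (LinearMap.mem_range_self _ _)
    rw [PiLp.inner_apply] at h
    rw [← h]
    refine Finset.sum_congr rfl fun a _ => ?_
    rw [L2.inner_def]
    refine integral_congr_ae ?_
    filter_upwards [(memLp_partial1 Ω ⟨_, hmem n⟩ a).coeFn_toLp] with x hx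
    rw [← hx]
    rfl
  have hχ1 : ∀ x, Tendsto (fun n => χ (s n • x)) atTop (𝓝 1) := by
    intro x
    have h1 : Tendsto (fun n => s n • x) atTop (𝓝 0) := by
      simpa using hslim.smul_const x
    have h2 := (χ.continuous.tendsto 0).comp h1
    rwa [χ.one_of_mem_closedBall (Metric.mem_closedBall_self χ.rIn_pos.le)] at h2
  have hχle : ∀ n x, ‖χ (s n • x)‖ ≤ 1 := fun n x => by
    rw [Real.norm_of_nonneg χ.nonneg]
    exact χ.le_one
  have hlim : Tendsto (fun n => ∑ a, ∫ x in Ω, inner ℂ (w a x)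
      (partial1 (fun x => χ (s n • x) • f x) a x)) atTop
      (𝓝 (∑ a, ∫ x in Ω, inner ℂ (w a x) (partial1 f a x))) := by
    refine tendsto_finsetSum _ fun a _ => ?_
    have hwm : MemLp (fun x => ‖w a x‖) 2 (volume.restrict Ω) := (Lp.memLp (w a)).norm
    have hmeas : ∀ n, AEStronglyMeasurable
        (fun x => inner ℂ (w a x) (partial1 (fun x => χ (s n • x) • f x) a x))
        (volume.restrict Ω) := fun n =>
      (Lp.memLp (w a)).1.inner (memLp_partial1 Ω ⟨_, hmem n⟩ a).1
    cases a with
    | none =>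
      refine tendsto_integral_of_dominated_convergence (fun x => ‖w none x‖ * ‖f x‖) hmeas
        (hwm.integrable_mul (hL none).norm) (fun n => .of_forall fun x => ?_)
        (.of_forall fun x => ?_)
      · refine (norm_inner_le_norm _ _).trans ?_
        gcongr
        simp only [partial1]
        rw [norm_smul]
        exact mul_le_of_le_one_left (norm_nonneg _) (hχle n x)
      · simp only [partial1]
        refine Tendsto.inner tendsto_const_nhds ?_
        simpa using (hχ1 x).smul_const (f x)
    | some k =>
      have hd : ∀ n x, partial1 (fun x => χ (s n • x) • f x) (some k) x
          = χ (s n • x) • fderiv ℝ f x (e k) + (s n * fderiv ℝ χ (s n • x) (e k)) • f x := by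
        intro n x
        have h1 : HasFDerivAt (fun y : E N => χ (s n • y))
            ((fderiv ℝ χ (s n • x)).comp (s n • ContinuousLinearMap.id ℝ (E N))) x :=
          (hχ.differentiable (by simp) _).hasFDerivAt.comp x ((hasFDerivAt_id x).const_smul (s n))
        have h2 : fderiv ℝ (fun y => χ (s n • y) • f y) x = _ :=
          (h1.fun_smul (hf.differentiable (by simp) x).hasFDerivAt).fderiv
        simp only [partial1]
        rw [h2]
        simp
      have hχ' : Continuous fun x => fderiv ℝ χ x (e k) := (contDiff_fderiv_apply hχ (e k)).continuous
      obtain ⟨M, hM⟩ := (χ.hasCompactSupport.fderiv_apply ℝ (e k)).exists_bound_of_continuous hχ'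
      have hM0 : 0 ≤ M := (norm_nonneg _).trans (hM 0)
      refine tendsto_integral_of_dominated_convergence
        (fun x => ‖w (some k) x‖ * (‖partial1 f (some k) x‖ + M * ‖f x‖)) hmeas
        (hwm.integrable_mul ((hL (some k)).norm.add ((hL none).norm.const_mul M)))
        (fun n => .of_forall fun x => ?_) (.of_forall fun x => ?_)
      · refine (norm_inner_le_norm _ _).trans ?_
        rw [hd]
        gcongr
        refine (norm_add_le _ _).trans ?_
        rw [norm_smul, norm_smul, norm_mul]
        refine add_le_add (mul_le_of_le_one_left (norm_nonneg _) (hχle n x)) ?_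
        gcongr
        calc ‖s n‖ * ‖fderiv ℝ χ (s n • x) (e k)‖ ≤ 1 * M := by
              gcongr
              · exact hs1 n
              · exact hM _
          _ = M := one_mul M
      · simp only [hd]
        refine Tendsto.inner tendsto_const_nhds ?_
        have h1 : Tendsto (fun n => s n * fderiv ℝ χ (s n • x) (e k)) atTop (𝓝 0) :=
          bdd_le_mul_tendsto_zero' M (.of_forall fun n => hM _) hslim |>.congr fun n => mul_comm _ _
        simpa [partial1] using ((hχ1 x).smul_const (fderiv ℝ f x (e k))).add (h1.smul_const (f x))
  have h0 := tendsto_nhds_unique hlim (by simpa only [hzero] using tendsto_const_nhds)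
  rw [PiLp.inner_apply, ← h0]
  refine Finset.sum_congr rfl fun a _ => ?_
  rw [L2.inner_def]
  refine integral_congr_ae ?_
  filter_upwards [(hL a).coeFn_toLp] with x hx
  rw [← hx]

theorem exists_represents {ψ : Form N q} (hψ : ContDiff ℝ ∞ ψ)
    (hL : ∀ I a, MemLp (partial1 (coeff ψ I) a) 2 (volume.restrict Ω)) :
    ∃ u : W1Forms Ω q, Represents u ψ :=
  ⟨WithLp.toLp 2 fun I => ⟨_, toLp_mem_W1 (contDiff_eval hψ _) (hL I)⟩,
    fun I a => (hL I a).coeFn_toLp⟩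

/-! ### The domain of the adjoint -/

theorem norm_jet_coeff_le (φ : testForms N q) (J : MultiIndex N q) :
    ‖jet Ω ⟨coeff (φ : Form N q) J, coeff_mem φ J⟩‖ ≤ ‖formClass Ω q φ‖ :=
  PiLp.norm_apply_le (p := 2) (β := fun _ : MultiIndex N q => W1 Ω) (formClass Ω q φ) J

theorem norm_formClass_sq (φ : testForms N q) :
    ‖formClass Ω q φ‖ ^ 2
      = ∑ J, ‖jet Ω ⟨coeff (φ : Form N q) J, coeff_mem φ J⟩‖ ^ 2 :=
  PiLp.norm_sq_eq_of_L2 (fun _ : MultiIndex N q => W1 Ω) (formClass Ω q φ)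

theorem contDiff_contract {ψ : Form N (q + 1)} (hψ : ContDiff ℝ ∞ ψ) (n : E N) (v : Fin q → E N) :
    ContDiff ℝ ∞ fun x => contract (ψ x) n v :=
  contDiff_eval hψ _

theorem fderiv_contract {ψ : Form N (q + 1)} (hψ : ContDiff ℝ ∞ ψ) (n : E N) (v : Fin q → E N)
    (x w : E N) :
    fderiv ℝ (fun y => contract (ψ y) n v) x w = contract (fderiv ℝ ψ x w) n v :=
  fderiv_eval hψ _ x w

/-- A smooth form is in the domain of `d^*` if its second order functionals `∑ a_jk ∂_j ∂_k`, with
`a_jk` the conjugate of the coefficient `J` of `∂_j ψ ⌊ e_k`, can be written with matrices `b` that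
are tangential on the boundary and have a square integrable divergence. -/
theorem inDomDStar_of_tangential (hρ : IsDefiningFunction ρ Ω) {ψ : Form N (q + 1)}
    (hψ : ContDiff ℝ ∞ ψ) (h1 : ∀ I a, MemLp (partial1 (coeff ψ I) a) 2 (volume.restrict Ω))
    (h0 : ∀ k v, MemLp (fun x => contract (ψ x) (e k) v) 2 (volume.restrict Ω))
    {b : MultiIndex N q → Fin (N + 1) → Fin (N + 1) → E N → ℂ}
    (hb : ∀ J j k, ContDiff ℝ ∞ (b J j k))
    (hab : ∀ J j k x, b J j k x + b J k j x
      = star (contract (fderiv ℝ ψ x (e j)) (e k) fun i => e (J i))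
        + star (contract (fderiv ℝ ψ x (e k)) (e j) fun i => e (J i)))
    (ht : ∀ J, ∀ x ∈ frontier Ω, ∀ k, ∑ j, fderiv ℝ ρ x (e j) • b J j k x = 0)
    (hL : ∀ J j k, MemLp (fun x => fderiv ℝ (b J j k) x (e j)) 2 (volume.restrict Ω)) :
    InDomDStar Ω ψ := by
  obtain ⟨u, hu⟩ := exists_represents hψ h1
  refine ⟨u, (mem_dStar_domain hρ.isOpen q u).2 ?_, hu⟩
  have hsplit : ∀ φ : testForms N q, inner ℂ u (formClass Ω (q + 1) (extD N q φ))
      = ∑ J : MultiIndex N q, ((∑ k, ∫ x in Ω, star (contract (ψ x) (e k) fun i => e (J i))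
          * partial1 (coeff (φ : Form N q) J) (some k) x)
        + ∫ x in Ω, ∑ j, ∑ k, star (contract (fderiv ℝ ψ x (e j)) (e k) fun i => e (J i))
          * fderiv ℝ (fderiv ℝ (coeff (φ : Form N q) J)) x (e j) (e k)) := by
    intro φ
    have hφ := fun J => coeff_mem φ J
    have i1 : ∀ (J : MultiIndex N q) (k : Fin (N + 1)), Integrable
        (fun x => star (contract (ψ x) (e k) fun i => e (J i))
          * fderiv ℝ (coeff (φ : Form N q) J) x (e k)) (volume.restrict Ω) := fun J k =>
      (((contDiff_contract hψ _ _).continuous.star.mul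
        (contDiff_fderiv_apply (hφ J).1 (e k)).continuous).integrable_of_hasCompactSupport
          ((hφ J).2.fderiv_apply ℝ (e k)).mul_left).restrict
    have i2 : ∀ (J : MultiIndex N q) (j k : Fin (N + 1)), Integrable
        (fun x => star (contract (fderiv ℝ ψ x (e j)) (e k) fun i => e (J i))
          * fderiv ℝ (fderiv ℝ (coeff (φ : Form N q) J)) x (e j) (e k)) (volume.restrict Ω) := by
      intro J j k
      simp only [← fderiv_fderiv_apply (hφ J).1]
      exact (((contDiff_contract (contDiff_fderiv_apply hψ (e j)) _ _).continuous.star.mul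
        (contDiff_fderiv_apply (contDiff_fderiv_apply (hφ J).1 (e k))
          (e j)).continuous).integrable_of_hasCompactSupport
          (((hφ J).2.fderiv_apply ℝ (e k)).fderiv_apply ℝ (e j)).mul_left).restrict
    have i3 := fun J => integrable_finsetSum Finset.univ fun k _ => i1 J k
    have i4 := fun J => integrable_finsetSum Finset.univ fun j _ =>
      integrable_finsetSum Finset.univ fun k _ => i2 J j k
    rw [inner_formClass_extD hψ hu]
    refine (integral_finsetSum _ fun J _ => (i3 J).add (i4 J)).trans ?_
    refine Finset.sum_congr rfl fun J _ => ?_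
    refine (integral_add (i3 J) (i4 J)).trans ?_
    congr 1
    exact integral_finsetSum _ fun k _ => i1 J k
  -- a bound in terms of the norm of a coefficient is a bound in terms of the norm of the form
  have hmono : ∀ (J : MultiIndex N q) (L : testFunctions N → ℂ),
      (∃ C : ℝ, ∀ f, ‖L f‖ ≤ C * ‖jet Ω f‖) →
      ∃ C : ℝ, ∀ φ : testForms N q, ‖L ⟨coeff (φ : Form N q) J, coeff_mem φ J⟩‖
        ≤ C * ‖formClass Ω q φ‖ := by
    rintro J L ⟨C, hC⟩
    refine ⟨|C|, fun φ => (hC _).trans ?_⟩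
    gcongr
    · exact le_abs_self C
    · exact norm_jet_coeff_le φ J
  simp only [hsplit]
  refine exists_norm_sum_le fun J => ?_
  obtain ⟨C, hC⟩ : ∃ C : ℝ, ∀ φ : testForms N q,
      ‖∑ k, ∫ x in Ω, star (contract (ψ x) (e k) fun i => e (J i))
          * partial1 (coeff (φ : Form N q) J) (some k) x‖ ≤ C * ‖formClass Ω q φ‖ :=
    exists_norm_sum_le fun k => hmono J
      (fun f => ∫ x in Ω, star (contract (ψ x) (e k) fun i => e (J i))
        * partial1 (f : E N → ℂ) (some k) x)
      (exists_norm_integral_mul_partial1_le (h0 k _).star (some k))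
  obtain ⟨D, hD⟩ := hmono J (fun f => ∫ x in Ω, ∑ j, ∑ k,
      star (contract (fderiv ℝ ψ x (e j)) (e k) fun i => e (J i))
        * fderiv ℝ (fderiv ℝ (f : E N → ℂ)) x (e j) (e k))
    (exists_norm_integral_second_order_le hρ (hb J) (hab J) (ht J) (hL J))
  refine ⟨C + D, fun φ => (norm_add_le _ _).trans ?_⟩
  rw [add_mul]
  exact add_le_add (hC φ) (hD φ)

theorem contract_fderiv_eq_sum {ψ : Form N (q + 1)} (hψ : ContDiff ℝ ∞ ψ) (x v w : E N)
    (t : Fin q → E N) :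
    contract (fderiv ℝ ψ x v) w t
      = ∑ j, ∑ k, (v j * w k) • contract (fderiv ℝ ψ x (e j)) (e k) t := by
  have h1 : contract (fderiv ℝ ψ x v) w t = ∑ j, v j • contract (fderiv ℝ ψ x (e j)) w t := by
    have h := map_eq_sum_coord (fderiv ℝ (fun y => contract (ψ y) w t) x).toLinearMap v
    simpa only [ContinuousLinearMap.coe_coe, fderiv_contract hψ] using h
  rw [h1]
  refine Finset.sum_congr rfl fun j _ => ?_
  have h2 := congrArg (fun η : E N [⋀^Fin q]→L[ℝ] ℂ => η t)
    (map_eq_sum_coord (fderiv ℝ ψ x (e j)).curryLeft.toLinearMap w)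
  simp only [ContinuousLinearMap.coe_coe, ContinuousAlternatingMap.sum_apply,
    ContinuousAlternatingMap.smul_apply] at h2
  change contract (fderiv ℝ ψ x (e j)) w t
    = ∑ k, w k • contract (fderiv ℝ ψ x (e j)) (e k) t at h2
  rw [h2, Finset.smul_sum]
  simp only [smul_smul]

theorem gradient_apply (hρ : IsDefiningFunction ρ Ω) (x : E N) (j : Fin (N + 1)) :
    gradient ρ x j = fderiv ℝ ρ x (e j) := by
  rw [fderiv_apply_gradient hρ, e, EuclideanSpace.inner_single_right]
  simp

/-- The form `f η` with a test function `f` and a constant form `η`. -/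
def constForm (η : E N [⋀^Fin q]→L[ℝ] ℂ) (f : testFunctions N) : testForms N q :=
  ⟨fun x => (f : E N → ℂ) x • η, f.2.1.smul contDiff_const,
    HasCompactSupport.intro f.2.2 fun x hx => by
      rw [image_eq_zero_of_notMem_tsupport hx]
      exact ContinuousAlternatingMap.ext fun v => zero_mul (η v)⟩

theorem coeff_constForm (η : E N [⋀^Fin q]→L[ℝ] ℂ) (f : testFunctions N) (J : MultiIndex N q) :
    coeff (constForm η f : Form N q) J = fun x => (η fun i => e (J i)) * (f : E N → ℂ) x := by
  funext x
  exact mul_comm _ _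

theorem norm_formClass_constForm (η : E N [⋀^Fin q]→L[ℝ] ℂ) (f : testFunctions N) :
    ‖formClass Ω q (constForm η f)‖
      = √(∑ J : MultiIndex N q, ‖η fun i => e (J i)‖ ^ 2) * ‖jet Ω f‖ := by
  rw [← Real.sqrt_sq (norm_nonneg (formClass Ω q (constForm η f))), norm_formClass_sq,
    ← Real.sqrt_sq (norm_nonneg (jet Ω f)), ← Real.sqrt_mul (by positivity), Finset.sum_mul]
  congr 1
  refine Finset.sum_congr rfl fun J _ => ?_
  have h1 : (⟨_, coeff_mem (constForm η f) J⟩ : testFunctions N) = (η fun i => e (J i)) • f :=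
    Subtype.ext (coeff_constForm η f J)
  rw [h1, map_smul, norm_smul, mul_pow]

theorem fderiv_const_mul_apply {f : E N → ℂ} (hf : ContDiff ℝ ∞ f) (z : ℂ) (x w : E N) :
    fderiv ℝ (fun x => z * f x) x w = z * fderiv ℝ f x w := by
  rw [fderiv_const_mul (hf.differentiable (by simp) x)]
  rfl

theorem fderiv_fderiv_const_mul_apply {f : E N → ℂ} (hf : ContDiff ℝ ∞ f) (z : ℂ) (x v w : E N) :
    fderiv ℝ (fderiv ℝ (fun x => z * f x)) x v w = z * fderiv ℝ (fderiv ℝ f) x v w := by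
  rw [← fderiv_fderiv_apply (contDiff_const.mul hf), ← fderiv_fderiv_apply hf]
  simp only [fderiv_const_mul_apply hf]
  exact fderiv_const_mul_apply (contDiff_fderiv_apply hf w) z x v

theorem inner_formClass_extD_constForm {u : W1Forms Ω (q + 1)} {ψ : Form N (q + 1)}
    (hψ : ContDiff ℝ ∞ ψ) (hu : Represents u ψ) (η : E N [⋀^Fin q]→L[ℝ] ℂ) (f : testFunctions N) :
    inner ℂ u (formClass Ω (q + 1) (extD N q (constForm η f)))
      = ∫ x in Ω, (∑ k, (∑ J : MultiIndex N q, star (contract (ψ x) (e k) fun i => e (J i))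
            * η fun i => e (J i)) * fderiv ℝ (f : E N → ℂ) x (e k)
        + ∑ j, ∑ k, (∑ J : MultiIndex N q,
            star (contract (fderiv ℝ ψ x (e j)) (e k) fun i => e (J i)) * η fun i => e (J i))
              * fderiv ℝ (fderiv ℝ (f : E N → ℂ)) x (e j) (e k)) := by
  rw [inner_formClass_extD hψ hu]
  refine integral_congr_ae (.of_forall fun x => ?_)
  simp only [coeff_constForm, fderiv_const_mul_apply f.2.1, fderiv_fderiv_const_mul_apply f.2.1,
    Finset.sum_mul, Finset.sum_add_distrib, mul_assoc]
  congr 1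
  · exact Finset.sum_comm
  · rw [Finset.sum_comm (s := (Finset.univ : Finset (MultiIndex N q)))]
    exact Finset.sum_congr rfl fun j _ => Finset.sum_comm

/-- The boundary condition is necessary: the form is tested against `f η` with functions `f` and the
constant form `η` that is the value of the normal component of `∇_n ψ` at the point in question. -/
theorem contract_gradient_eq_zero (hρ : IsDefiningFunction ρ Ω) {ψ : Form N (q + 1)}
    (hψ : ContDiff ℝ ∞ ψ) (h : InDomDStar Ω ψ) {p : E N} (hp : p ∈ frontier Ω) :
    contract (fderiv ℝ ψ p (gradient ρ p)) (gradient ρ p) = 0 := by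
  obtain ⟨u, hu, hrep⟩ := h
  obtain ⟨C, hC⟩ := (mem_dStar_domain hρ.isOpen q u).1 hu
  set η := contract (fderiv ℝ ψ p (gradient ρ p)) (gradient ρ p) with hη
  set z : MultiIndex N q → ℂ := fun J => η fun i => e (J i) with hz
  set a : Fin (N + 1) → Fin (N + 1) → E N → ℂ := fun j k x =>
    ∑ J : MultiIndex N q, star (contract (fderiv ℝ ψ x (e j)) (e k) fun i => e (J i)) * z J with ha
  set c : Fin (N + 1) → E N → ℂ := fun k x =>
    ∑ J : MultiIndex N q, star (contract (ψ x) (e k) fun i => e (J i)) * z J with hc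
  have hac : ∀ j k, Continuous (a j k) := fun j k => continuous_finsetSum _ fun J _ =>
    (contDiff_contract (contDiff_fderiv_apply hψ (e j)) _ _).continuous.star.mul continuous_const
  have hcc : ∀ k, Continuous (c k) := fun k => continuous_finsetSum _ fun J _ =>
    (contDiff_contract hψ _ _).continuous.star.mul continuous_const
  have hkey := sum_normal_component_eq_zero hρ hac hcc (C := C * √(∑ J, ‖z J‖ ^ 2)) (fun f => by
    have h1 := hC (constForm η f)
    rw [norm_formClass_constForm, inner_formClass_extD_constForm hψ hrep, ← mul_assoc] at h1
    exact h1) hp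
  have hsum : ∑ J, star (z J) * z J = 0 := by
    rw [← hkey]
    have hzJ : ∀ J, star (z J) = ∑ j, ∑ k, (fderiv ℝ ρ p (e j) * fderiv ℝ ρ p (e k)) •
        star (contract (fderiv ℝ ψ p (e j)) (e k) fun i => e (J i)) := by
      intro J
      simp only [hz, hη]
      rw [contract_fderiv_eq_sum hψ]
      simp only [star_sum, star_smul, gradient_apply hρ, star_trivial]
    simp only [hzJ, ha, Finset.sum_mul, Finset.smul_sum, smul_mul_assoc]
    rw [Finset.sum_comm]
    exact Finset.sum_congr rfl fun j _ => Finset.sum_comm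
  have hsum' : ∑ J, ‖z J‖ ^ 2 = 0 := by
    have h1 : ∀ J, star (z J) * z J = ((‖z J‖ ^ 2 : ℝ) : ℂ) := fun J => by
      rw [mul_comm, Complex.star_def, Complex.mul_conj, Complex.normSq_eq_norm_sq]
    simp only [h1] at hsum
    exact_mod_cast hsum
  refine coeff_ext fun J => ?_
  have h2 := (Finset.sum_eq_zero_iff_of_nonneg fun J _ => sq_nonneg ‖z J‖).1 hsum' J
    (Finset.mem_univ J)
  simpa [hz] using h2

/-! ### Square integrability, conjugation and scaling of contractions -/

theorem memLp_of_isCompact {V : Type*} [NormedAddCommGroup V] {g : E N → V} (hg : Continuous g)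
    (hΩ : MeasurableSet Ω) {K : Set (E N)} (hK : IsCompact K) (h : ∀ x ∈ Ω, x ∉ K → g x = 0) :
    MemLp g 2 (volume.restrict Ω) := by
  obtain ⟨C, hC⟩ := hK.exists_bound_of_continuousOn hg.continuousOn
  have h1 : MemLp (K.indicator fun _ => (1 : ℝ)) 2 (volume.restrict Ω) :=
    memLp_indicator_const 2 hK.isClosed.measurableSet 1
      (Or.inr ((Measure.restrict_apply_le _ _).trans_lt hK.measure_lt_top).ne)
  refine h1.of_le_mul (c := C) hg.aestronglyMeasurable ?_
  filter_upwards [ae_restrict_mem hΩ] with x hx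
  by_cases hxK : x ∈ K
  · simpa [hxK] using hC x hxK
  · simp [hxK, h x hx hxK]

theorem contDiff_star {f : E N → ℂ} (hf : ContDiff ℝ ∞ f) : ContDiff ℝ ∞ fun x => star (f x) :=
  Complex.conjCLE.contDiff.comp hf

theorem fderiv_star_apply {f : E N → ℂ} (hf : ContDiff ℝ ∞ f) (x w : E N) :
    fderiv ℝ (fun x => star (f x)) x w = star (fderiv ℝ f x w) := by
  have h := Complex.conjCLE.toContinuousLinearMap.hasFDerivAt.comp x
    (hf.differentiable (by simp) x).hasFDerivAt
  have h2 : fderiv ℝ (fun x => star (f x)) x = _ := h.fderiv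
  rw [h2]
  rfl

theorem contract_smul_smul (η : E N [⋀^Fin (q + 1)]→L[ℝ] ℂ) (c : ℝ) (n : E N) :
    contract (c • η) (c • n) = (c * c) • contract η n := by
  ext v
  simp only [contract_apply, ContinuousAlternatingMap.smul_apply]
  have h := congrArg (fun θ : E N [⋀^Fin q]→L[ℝ] ℂ => θ v) (map_smul η.curryLeft c n)
  simp only [ContinuousAlternatingMap.smul_apply] at h
  change η (Matrix.vecCons (c • n) v) = c • η (Matrix.vecCons n v) at h
  rw [h, smul_smul]

/-! ### Smoothly bounded domains -/

/-- The part of `a` that is tangential to the level sets of `ρ` where `∑ ρ_j n_j = 1` and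
`∑ ρ_j ρ_k a_jk = 0`; the difference to `a` is antisymmetric. -/
def tangentialPart (ρ : E N → ℝ) (n : Fin (N + 1) → E N → ℝ)
    (a : Fin (N + 1) → Fin (N + 1) → E N → ℂ) (j k : Fin (N + 1)) (x : E N) : ℂ :=
  a j k x - n j x • ∑ i, fderiv ℝ ρ x (e i) • a i k x + n k x • ∑ i, fderiv ℝ ρ x (e i) • a i j x

theorem tangentialPart_add_swap (n : Fin (N + 1) → E N → ℝ)
    (a : Fin (N + 1) → Fin (N + 1) → E N → ℂ) (j k : Fin (N + 1)) (x : E N) :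
    tangentialPart ρ n a j k x + tangentialPart ρ n a k j x = a j k x + a k j x := by
  simp only [tangentialPart]
  ring

theorem contDiff_tangentialPart (hρ : ContDiff ℝ ∞ ρ) {n : Fin (N + 1) → E N → ℝ}
    (hn : ∀ j, ContDiff ℝ ∞ (n j)) {a : Fin (N + 1) → Fin (N + 1) → E N → ℂ}
    (ha : ∀ j k, ContDiff ℝ ∞ (a j k)) (j k : Fin (N + 1)) :
    ContDiff ℝ ∞ (tangentialPart ρ n a j k) := by
  have hT : ∀ k, ContDiff ℝ ∞ fun x => ∑ i, fderiv ℝ ρ x (e i) • a i k x := fun k =>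
    ContDiff.sum fun i _ => (contDiff_fderiv_apply hρ (e i)).smul (ha i k)
  exact ((ha j k).sub ((hn j).smul (hT k))).add ((hn k).smul (hT j))

theorem sum_smul_tangentialPart {n : Fin (N + 1) → E N → ℝ}
    {a : Fin (N + 1) → Fin (N + 1) → E N → ℂ} {x : E N}
    (hn : ∑ j, fderiv ℝ ρ x (e j) * n j x = 1)
    (ha : ∑ j, ∑ k, (fderiv ℝ ρ x (e j) * fderiv ℝ ρ x (e k)) • a j k x = 0) (k : Fin (N + 1)) :
    ∑ j, fderiv ℝ ρ x (e j) • tangentialPart ρ n a j k x = 0 := by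
  have h1 : ∑ j, fderiv ℝ ρ x (e j) • ∑ i, fderiv ℝ ρ x (e i) • a i j x = 0 := by
    rw [← ha, Finset.sum_comm]
    refine Finset.sum_congr rfl fun j _ => ?_
    rw [Finset.smul_sum]
    refine Finset.sum_congr rfl fun i _ => ?_
    rw [smul_smul, mul_comm]
  simp only [tangentialPart, smul_add, smul_sub, Finset.sum_add_distrib, Finset.sum_sub_distrib]
  have h2 : ∑ j, fderiv ℝ ρ x (e j) • n j x • ∑ i, fderiv ℝ ρ x (e i) • a i k x
      = ∑ i, fderiv ℝ ρ x (e i) • a i k x := by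
    simp only [smul_smul, ← Finset.sum_smul]
    rw [hn, one_smul]
  have h3 : ∑ j, fderiv ℝ ρ x (e j) • n k x • ∑ i, fderiv ℝ ρ x (e i) • a i j x = 0 := by
    simp only [smul_comm _ (n k x)]
    rw [← Finset.smul_sum, h1, smul_zero]
  rw [h2, h3]
  simp

/-- A smooth vector field with normal derivative one on the boundary,
`∇ρ / (|∇ρ|² + κ)` where `κ ≥ 0` vanishes exactly on the boundary. -/
theorem exists_transversal (hρ : IsDefiningFunction ρ Ω) :
    ∃ n : Fin (N + 1) → E N → ℝ, (∀ j, ContDiff ℝ ∞ (n j)) ∧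
      ∀ x ∈ frontier Ω, ∑ j, fderiv ℝ ρ x (e j) * n j x = 1 := by
  obtain ⟨κ, hκs, hκ, hκr⟩ := (isClosed_frontier (s := Ω)).isOpen_compl.exists_contDiff_support_eq
    (n := ⊤)
  have hκ0 : ∀ x, 0 ≤ κ x := fun x => (hκr (mem_range_self x)).1
  set S : E N → ℝ := fun x => ∑ j, fderiv ℝ ρ x (e j) ^ 2 + κ x with hS
  have hρj : ∀ j, ContDiff ℝ ∞ fun x => fderiv ℝ ρ x (e j) := fun j =>
    contDiff_fderiv_apply hρ.contDiff (e j)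
  have hSc : ContDiff ℝ ∞ S := (ContDiff.sum fun j _ => (hρj j).pow 2).add hκ
  have hsq : ∀ x ∈ frontier Ω, ∑ j, fderiv ℝ ρ x (e j) ^ 2 ≠ 0 := by
    intro x hx h
    have h1 := (Finset.sum_eq_zero_iff_of_nonneg fun j _ => sq_nonneg (fderiv ℝ ρ x (e j))).1 h
    refine hρ.gradient_ne_zero x hx ?_
    ext j
    rw [gradient_apply hρ]
    exact pow_eq_zero_iff two_ne_zero |>.1 (h1 j (Finset.mem_univ j))
  have hκf : ∀ x ∈ frontier Ω, κ x = 0 := fun x hx => by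
    have : x ∉ Function.support κ := by
      rw [hκs]
      exact fun h => h hx
    exact Function.notMem_support.1 this
  have hS0 : ∀ x, S x ≠ 0 := by
    intro x
    by_cases hx : x ∈ frontier Ω
    · simp only [hS, hκf x hx, add_zero]
      exact hsq x hx
    · have h1 : κ x ≠ 0 := by
        rw [← Function.mem_support, hκs]
        exact hx
      have h2 : 0 < κ x := lt_of_le_of_ne (hκ0 x) h1.symm
      have h3 : 0 ≤ ∑ j, fderiv ℝ ρ x (e j) ^ 2 := Finset.sum_nonneg fun j _ => sq_nonneg _
      exact (add_pos_of_nonneg_of_pos h3 h2).ne'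
  refine ⟨fun j x => fderiv ℝ ρ x (e j) / S x, fun j => (hρj j).div hSc hS0, fun x hx => ?_⟩
  have h1 : S x = ∑ j, fderiv ℝ ρ x (e j) ^ 2 := by
    simp only [hS, hκf x hx, add_zero]
  simp only [← mul_div_assoc, ← sq]
  rw [← Finset.sum_div, ← h1, div_self (hS0 x)]

theorem sum_star_contract_eq_zero (hρ : IsDefiningFunction ρ Ω) {ψ : Form N (q + 1)}
    (hψ : ContDiff ℝ ∞ ψ) {x : E N}
    (h : contract (fderiv ℝ ψ x (gradient ρ x)) (gradient ρ x) = 0) (v : Fin q → E N) :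
    ∑ j, ∑ k, (fderiv ℝ ρ x (e j) * fderiv ℝ ρ x (e k)) •
      star (contract (fderiv ℝ ψ x (e j)) (e k) v) = 0 := by
  have h1 : contract (fderiv ℝ ψ x (gradient ρ x)) (gradient ρ x) v = 0 := by
    rw [h]
    rfl
  rw [contract_fderiv_eq_sum hψ] at h1
  have h2 := congrArg star h1
  simpa only [star_sum, star_smul, gradient_apply hρ, star_trivial, star_zero] using h2

theorem inDomDStar_of_isBounded (hρ : IsDefiningFunction ρ Ω) (hb : Bornology.IsBounded Ω)
    {ψ : Form N (q + 1)} (hψ : ContDiff ℝ ∞ ψ)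
    (h : ∀ x ∈ frontier Ω, contract (fderiv ℝ ψ x (gradient ρ x)) (gradient ρ x) = 0) :
    InDomDStar Ω ψ := by
  have hL : ∀ {f : E N → ℂ}, Continuous f → MemLp f 2 (volume.restrict Ω) := fun hf =>
    memLp_of_isCompact hf hρ.isOpen.measurableSet hb.isCompact_closure
      fun x hx hx' => absurd (subset_closure hx) hx'
  obtain ⟨n, hn, hn1⟩ := exists_transversal hρ
  set a : MultiIndex N q → Fin (N + 1) → Fin (N + 1) → E N → ℂ := fun J j k x =>
    star (contract (fderiv ℝ ψ x (e j)) (e k) fun i => e (J i)) with ha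
  have hac : ∀ J j k, ContDiff ℝ ∞ (a J j k) := fun J j k =>
    contDiff_star (contDiff_contract (contDiff_fderiv_apply hψ (e j)) _ _)
  have hbc := fun J j k => contDiff_tangentialPart hρ.contDiff hn (hac J) j k
  have h1 : ∀ I o, MemLp (partial1 (coeff ψ I) o) 2 (volume.restrict Ω) := by
    intro I o
    cases o with
    | none => exact hL (contDiff_eval hψ _).continuous
    | some j => exact hL (contDiff_fderiv_apply (contDiff_eval hψ _) (e j)).continuous
  have h0 : ∀ k v, MemLp (fun x => contract (ψ x) (e k) v) 2 (volume.restrict Ω) := fun k v =>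
    hL (contDiff_contract hψ _ _).continuous
  have ht : ∀ J, ∀ x ∈ frontier Ω, ∀ k,
      ∑ j, fderiv ℝ ρ x (e j) • tangentialPart ρ n (a J) j k x = 0 := fun J x hx k =>
    sum_smul_tangentialPart (n := n) (a := a J) (hn1 x hx)
      (sum_star_contract_eq_zero hρ hψ (h x hx) fun i => e (J i)) k
  have hb' : ∀ J j k, MemLp (fun x => fderiv ℝ (tangentialPart ρ n (a J) j k) x (e j)) 2
      (volume.restrict Ω) := fun J j k =>
    hL (contDiff_fderiv_apply (hbc J j k) (e j)).continuous
  exact inDomDStar_of_tangential hρ hψ h1 h0 (b := fun J => tangentialPart ρ n (a J)) hbc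
    (fun J j k x => tangentialPart_add_swap n (a J) j k x) ht hb'

theorem contract_unitNormal_eq_zero_iff (hρ : IsDefiningFunction ρ Ω) (ψ : Form N (q + 1))
    {x : E N} (hx : x ∈ frontier Ω) :
    contract (covDeriv (unitNormal ρ x) ψ x) (unitNormal ρ x) = 0
      ↔ contract (fderiv ℝ ψ x (gradient ρ x)) (gradient ρ x) = 0 := by
  have hc : ‖gradient ρ x‖⁻¹ ≠ 0 := inv_ne_zero (norm_ne_zero_iff.2 (hρ.gradient_ne_zero x hx))
  rw [covDeriv, unitNormal, map_smul, contract_smul_smul]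
  constructor
  · intro h
    ext v
    have h1 := congrArg (fun θ : E N [⋀^Fin q]→L[ℝ] ℂ => θ v) h
    exact (smul_eq_zero.1 h1).resolve_left (mul_ne_zero hc hc)
  · intro h
    ext v
    have h1 := congrArg (fun θ : E N [⋀^Fin q]→L[ℝ] ℂ => θ v) h
    exact smul_eq_zero.2 (Or.inr h1)

/-! ### The half space -/

theorem hasFDerivAt_neg_coord (x : E N) :
    HasFDerivAt (fun y : E N => -y 0) (-(EuclideanSpace.proj 0 : E N →L[ℝ] ℝ)) x :=
  (EuclideanSpace.proj (𝕜 := ℝ) (0 : Fin (N + 1))).hasFDerivAt.neg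

theorem gradient_neg_coord (x : E N) : gradient (fun y : E N => -y 0) x = -e 0 := by
  rw [gradient, LinearIsometryEquiv.symm_apply_eq, (hasFDerivAt_neg_coord x).fderiv]
  refine ContinuousLinearMap.ext fun y => ?_
  simp [e, EuclideanSpace.inner_single_left]

theorem isDefiningFunction_halfSpace :
    IsDefiningFunction (fun y : E N => -y 0) (halfSpace N) where
  contDiff := (EuclideanSpace.proj (𝕜 := ℝ) (0 : Fin (N + 1))).contDiff.neg
  eq_setOf_neg := by
    ext x
    simp [halfSpace]
  gradient_ne_zero x _ := by
    rw [gradient_neg_coord, neg_ne_zero]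
    intro h
    have := congrArg (fun y : E N => y 0) h
    simp [e] at this

theorem mem_frontier_halfSpace {x : E N} : x ∈ frontier (halfSpace N) ↔ x 0 = 0 := by
  refine ⟨fun hx => neg_eq_zero.1 (isDefiningFunction_halfSpace.eq_zero hx), fun hx => ?_⟩
  refine ⟨?_, ?_⟩
  · have h1 : Tendsto (fun t : ℝ => x + t • e 0) (𝓝[>] 0) (𝓝 (x + (0 : ℝ) • e 0)) :=
      ((continuous_const.add (continuous_id.smul continuous_const)).tendsto _).mono_left
        nhdsWithin_le_nhds
    rw [zero_smul, add_zero] at h1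
    refine mem_closure_of_tendsto h1 ?_
    filter_upwards [self_mem_nhdsWithin] with t ht
    have : 0 < t := ht
    simpa [halfSpace, hx, e] using this
  · rw [isDefiningFunction_halfSpace.isOpen.interior_eq]
    simp [halfSpace, hx]

theorem contract_neg_e_eq_zero_iff {ψ : Form N (q + 1)} (hψ : ContDiff ℝ ∞ ψ) (x : E N) :
    contract (fderiv ℝ ψ x (-e 0)) (-e 0) = 0
      ↔ ∀ J : MultiIndex N q, fderiv ℝ (coeffZero ψ J) x (e 0) = 0 := by
  have h1 : contract (fderiv ℝ ψ x (-e 0)) (-e 0) = contract (fderiv ℝ ψ x (e 0)) (e 0) := by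
    have h := contract_smul_smul (fderiv ℝ ψ x (e 0)) (-1) (e 0)
    rw [← map_smul] at h
    simp only [neg_smul, one_smul, mul_neg, mul_one, neg_neg] at h
    exact h
  have h2 : ∀ J : MultiIndex N q, fderiv ℝ (coeffZero ψ J) x (e 0)
      = contract (fderiv ℝ ψ x (e 0)) (e 0) fun i => e (J i) := fun J =>
    fderiv_contract hψ (e 0) _ x (e 0)
  simp only [h1, h2]
  exact ⟨fun h J => by rw [h]; rfl, fun h => coeff_ext fun J => h J⟩

theorem memLp_iteratedFDeriv_apply {ψ : Form N q} (hψ : ContDiff ℝ ∞ ψ) {k : ℕ}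
    (h : MemLp (iteratedFDeriv ℝ k ψ) 2 (volume.restrict Ω)) (m : Fin k → E N) (v : Fin q → E N) :
    MemLp (fun x => iteratedFDeriv ℝ k ψ x m v) 2 (volume.restrict Ω) := by
  have hc : Continuous fun x => iteratedFDeriv ℝ k ψ x m v :=
    (evalAt v).continuous.comp ((ContinuousMultilinearMap.apply ℝ (fun _ : Fin k => E N)
      (E N [⋀^Fin q]→L[ℝ] ℂ) m).continuous.comp (hψ.continuous_iteratedFDeriv (mod_cast le_top)))
  refine h.of_le_mul (c := (∏ i, ‖m i‖) * ∏ i, ‖v i‖) hc.aestronglyMeasurable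
    (.of_forall fun x => ?_)
  calc ‖iteratedFDeriv ℝ k ψ x m v‖ ≤ ‖iteratedFDeriv ℝ k ψ x m‖ * ∏ i, ‖v i‖ :=
        ContinuousAlternatingMap.le_opNorm _ _
    _ ≤ (‖iteratedFDeriv ℝ k ψ x‖ * ∏ i, ‖m i‖) * ∏ i, ‖v i‖ := by
        gcongr
        exact ContinuousMultilinearMap.le_opNorm _ _
    _ = _ := by ring

theorem inDomDStar_halfSpace {ψ : Form N (q + 1)} (hψ : ContDiff ℝ ∞ ψ)
    (hW : IsW2 (halfSpace N) ψ)
    (h : ∀ x : E N, x 0 = 0 → ∀ J : MultiIndex N q, fderiv ℝ (coeffZero ψ J) x (e 0) = 0) :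
    InDomDStar (halfSpace N) ψ := by
  have hρ := isDefiningFunction_halfSpace (N := N)
  have hL0 : ∀ v, MemLp (fun x => ψ x v) 2 (volume.restrict (halfSpace N)) := fun v => by
    simpa using memLp_iteratedFDeriv_apply hψ (hW 0 (by norm_num)) ![] v
  have hL1 : ∀ w v, MemLp (fun x => fderiv ℝ ψ x w v) 2 (volume.restrict (halfSpace N)) :=
    fun w v => by
      simpa [iteratedFDeriv_one_apply] using
        memLp_iteratedFDeriv_apply hψ (hW 1 (by norm_num)) ![w] v
  have hL2 : ∀ z w v, MemLp (fun x => fderiv ℝ (fderiv ℝ ψ) x z w v) 2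
      (volume.restrict (halfSpace N)) := fun z w v => by
    simpa [iteratedFDeriv_two_apply] using
      memLp_iteratedFDeriv_apply hψ (hW 2 le_rfl) ![z, w] v
  set a : MultiIndex N q → Fin (N + 1) → Fin (N + 1) → E N → ℂ := fun J j k x =>
    star (contract (fderiv ℝ ψ x (e j)) (e k) fun i => e (J i)) with ha
  have hac : ∀ J j k, ContDiff ℝ ∞ (a J j k) := fun J j k =>
    contDiff_star (contDiff_contract (contDiff_fderiv_apply hψ (e j)) _ _)
  have ha' : ∀ J j k l, MemLp (fun x => fderiv ℝ (a J j k) x (e l)) 2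
      (volume.restrict (halfSpace N)) := by
    intro J j k l
    have h1 : (fun x => fderiv ℝ (a J j k) x (e l)) = fun x => star
        (fderiv ℝ (fderiv ℝ ψ) x (e l) (e j) (Matrix.vecCons (e k) fun i => e (J i))) := by
      funext x
      rw [ha, fderiv_star_apply (contDiff_contract (contDiff_fderiv_apply hψ (e j)) _ _),
        fderiv_contract (contDiff_fderiv_apply hψ (e j)), fderiv_fderiv_apply hψ]
      rfl
    rw [h1]
    exact (hL2 _ _ _).star
  -- the coordinates of the constant field `e 0`
  set c : Fin (N + 1) → ℂ := fun j => if j = 0 then 1 else 0 with hc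
  set b : MultiIndex N q → Fin (N + 1) → Fin (N + 1) → E N → ℂ := fun J j k x =>
    a J j k x - c j * a J 0 k x + c k * a J 0 j x with hb
  have hbc : ∀ J j k, ContDiff ℝ ∞ (b J j k) := fun J j k =>
    ((hac J j k).sub (contDiff_const.mul (hac J 0 k))).add (contDiff_const.mul (hac J 0 j))
  refine inDomDStar_of_tangential hρ hψ ?_ (fun k v => hL0 _) hbc ?_ ?_ ?_
  · intro I o
    cases o with
    | none => exact hL0 _
    | some j =>
      have h1 : partial1 (coeff ψ I) (some j) = fun x => fderiv ℝ ψ x (e j) fun i => e (I i) := by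
        funext x
        exact fderiv_eval hψ _ x (e j)
      rw [h1]
      exact hL1 _ _
  · intro J j k x
    simp only [hb, ha]
    ring
  · intro J x hx k
    have hx0 := mem_frontier_halfSpace.1 hx
    have h00 : a J 0 0 x = 0 := by
      have h1 := h x hx0 J
      have h2 : fderiv ℝ (coeffZero ψ J) x (e 0)
          = contract (fderiv ℝ ψ x (e 0)) (e 0) fun i => e (J i) :=
        fderiv_contract hψ (e 0) _ x (e 0)
      rw [h2] at h1
      simp only [ha, h1, star_zero]
    have hd : ∀ j, fderiv ℝ (fun y : E N => -y 0) x (e j) = if j = 0 then -1 else 0 := by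
      intro j
      rw [(hasFDerivAt_neg_coord x).fderiv]
      by_cases hj : j = 0
      · subst hj
        simp [e]
      · simp [e, hj, Ne.symm hj]
    simp only [hd]
    rw [Finset.sum_eq_single 0 (fun j _ hj => by simp [hj]) (by simp)]
    simp [hb, hc, h00]
  · intro J j k
    have h1 : (fun x => fderiv ℝ (b J j k) x (e j)) = fun x => fderiv ℝ (a J j k) x (e j)
        - c j * fderiv ℝ (a J 0 k) x (e j) + c k * fderiv ℝ (a J 0 j) x (e j) := by
      funext x
      have d1 := fun i l => (hac J i l).differentiable (by simp) x
      have d2 : DifferentiableAt ℝ (fun y => a J j k y - c j * a J 0 k y) x :=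
        (d1 j k).sub ((d1 0 k).const_mul _)
      change fderiv ℝ (fun y => a J j k y - c j * a J 0 k y + c k * a J 0 j y) x (e j) = _
      rw [fderiv_fun_add d2 ((d1 0 j).const_mul _),
        fderiv_fun_sub (d1 j k) ((d1 0 k).const_mul _), fderiv_const_mul (d1 0 k),
        fderiv_const_mul (d1 0 j)]
      rfl
    rw [h1]
    exact ((ha' J j k j).sub ((ha' J 0 k j).const_mul _)).add ((ha' J 0 j j).const_mul _)

/-- Smooth forms with compact support in the closed half space have square integrable
derivatives. -/
theorem isW2_of_hasCompactSupport_indicator {ψ : Form N q} (hψ : ContDiff ℝ ∞ ψ)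
    (hc : HasCompactSupport ((closure (halfSpace N)).indicator ψ)) : IsW2 (halfSpace N) ψ := by
  have hO := (isDefiningFunction_halfSpace (N := N)).isOpen
  intro k _
  refine memLp_of_isCompact (hψ.continuous_iteratedFDeriv (mod_cast le_top)) hO.measurableSet hc
    fun x hx hx' => ?_
  have h1 : ψ =ᶠ[𝓝 x] fun _ => 0 := by
    filter_upwards [hO.mem_nhds hx, (isClosed_tsupport _).isOpen_compl.mem_nhds hx'] with y hy hy'
    rw [← image_eq_zero_of_notMem_tsupport hy', indicator_of_mem (subset_closure hy)]
  rw [(h1.iteratedFDeriv ℝ k).self_of_nhds, iteratedFDeriv_fun_zero]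
  rfl

end Forms

end SobolevHodge

end

theorem mainTheorem9 (N q : ℕ) (_hq : q ≤ N) :
    -- a smoothly bounded domain `Ω = {ρ < 0}` with unit normal `n = ∇ρ / |∇ρ|`
    (∀ (Ω : Set (SobolevHodge.E N)) (ρ : SobolevHodge.E N → ℝ),
      Bornology.IsBounded Ω → SobolevHodge.IsDefiningFunction ρ Ω →
      ∀ ψ : SobolevHodge.Form N (q + 1), ContDiff ℝ ∞ ψ →
        (SobolevHodge.InDomDStar Ω ψ ↔
          ∀ x ∈ frontier Ω,
            SobolevHodge.contract
              (SobolevHodge.covDeriv (SobolevHodge.unitNormal ρ x) ψ x)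
              (SobolevHodge.unitNormal ρ x) = 0)) ∧
    -- the half space with normal `-∂/∂x₀`, forms with compact support in its closure
    (∀ ψ : SobolevHodge.Form N (q + 1), ContDiff ℝ ∞ ψ →
      HasCompactSupport ((closure (SobolevHodge.halfSpace N)).indicator ψ) →
        (SobolevHodge.InDomDStar (SobolevHodge.halfSpace N) ψ ↔
          ∀ x ∈ frontier (SobolevHodge.halfSpace N),
            SobolevHodge.contract
              (SobolevHodge.covDeriv (-SobolevHodge.e 0) ψ x) (-SobolevHodge.e 0) = 0)) ∧
    -- the half space in coordinates, forms that are smooth up to the boundary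
    (∀ ψ : SobolevHodge.Form N (q + 1), ContDiff ℝ ∞ ψ →
      (SobolevHodge.InDomDStar (SobolevHodge.halfSpace N) ψ →
        ∀ x : SobolevHodge.E N, x 0 = 0 → ∀ J : SobolevHodge.MultiIndex N q,
          fderiv ℝ (SobolevHodge.coeffZero ψ J) x (SobolevHodge.e 0) = 0) ∧
      (SobolevHodge.IsW2 (SobolevHodge.halfSpace N) ψ →
        (∀ x : SobolevHodge.E N, x 0 = 0 → ∀ J : SobolevHodge.MultiIndex N q,
          fderiv ℝ (SobolevHodge.coeffZero ψ J) x (SobolevHodge.e 0) = 0) →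
        SobolevHodge.InDomDStar (SobolevHodge.halfSpace N) ψ)) := by
  have hH := SobolevHodge.isDefiningFunction_halfSpace (N := N)
  have hnec : ∀ ψ : SobolevHodge.Form N (q + 1), ContDiff ℝ ∞ ψ →
      SobolevHodge.InDomDStar (SobolevHodge.halfSpace N) ψ →
      ∀ x ∈ frontier (SobolevHodge.halfSpace N),
        SobolevHodge.contract (fderiv ℝ ψ x (-SobolevHodge.e 0)) (-SobolevHodge.e 0) = 0 := by
    intro ψ hψ h x hx
    have h1 := SobolevHodge.contract_gradient_eq_zero hH hψ h hx
    rwa [SobolevHodge.gradient_neg_coord] at h1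
  refine ⟨fun Ω ρ hb hρ ψ hψ => ⟨fun h x hx => ?_, fun h => ?_⟩,
    fun ψ hψ hc => ⟨hnec ψ hψ, fun h => ?_⟩, fun ψ hψ => ⟨fun h x hx => ?_, ?_⟩⟩
  · exact (SobolevHodge.contract_unitNormal_eq_zero_iff hρ ψ hx).2
      (SobolevHodge.contract_gradient_eq_zero hρ hψ h hx)
  · exact SobolevHodge.inDomDStar_of_isBounded hρ hb hψ fun x hx =>
      (SobolevHodge.contract_unitNormal_eq_zero_iff hρ ψ hx).1 (h x hx)
  · exact SobolevHodge.inDomDStar_halfSpace hψ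
      (SobolevHodge.isW2_of_hasCompactSupport_indicator hψ hc) fun x hx =>
        (SobolevHodge.contract_neg_e_eq_zero_iff hψ x).1
          (h x (SobolevHodge.mem_frontier_halfSpace.2 hx))
  · exact (SobolevHodge.contract_neg_e_eq_zero_iff hψ x).1
      (hnec ψ hψ h x (SobolevHodge.mem_frontier_halfSpace.2 hx))
  · exact SobolevHodge.inDomDStar_halfSpace hψ
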